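/- Let $D^{2,2,2}$ be the modular lattice with unity $I$ generated by $x_1,y_1,x_2,y_2,x_3,y_3$ subject only to $x_i\subseteq y_i$ ($i=1,2,3$); write $+$ and juxtaposition for its two operations (sum and intersection). **Representations and elementary maps.** A representation $\rho$ of $D^{2,2,2}$ in a vector space $X_0$ over a field is a lattice morphism from $D^{2,2,2}$ to the lattice of linear subspaces of $X_0$ with $\rho(I)=X_0$. Put $X_i=\rho(x_i)$, $Y_i=\rho(y_i)$ and $$X_0^1=\{(\eta_1,\eta_2,\eta_3)\mid \eta_i\in Y_i,\ \eta_1+\eta_2+\eta_3=0\}.$$ $\Phi^+\rho$ is the representation in $X_0^1$ with $\Phi^+\rho(x_i)=\{\eta\in X_0^1\mid \eta_i=0\}$ and $\Phi^+\rho(y_i)=\{\eta\in X_0^1\mid\eta_i\in X_i\}$, and $\varphi_i:X_0^1\to X_0$ is the linear map $(\eta_1,\eta_2,\eta_3)\mapsto\eta_i$. **Atomic elements.** For $\{i,j,k\}=\{1,2,3\}$ let $a_0^{ij}=A_0^{ij}=I$ and, for $n\ge1$, $a_n^{ij}=x_i+y_ja_{n-1}^{jk}$, $A_n^{ij}=y_i+x_jA_{n-1}^{ki}$.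 **Admissible sequences and elements.** A sequence $\alpha=i_n\dots i_2i_1$ of indices in $\{1,2,3\}$ is admissible if adjacent indices are distinct; its length is $n$ and it starts at $i_1$. Two sequences are identified if they are connected by replacements $\dots iji\dots=\dots iki\dots$ with $i,j,k$ distinct. The elements $f_\alpha,e_\alpha,g_{\alpha0}$ of an admissible sequence are defined by bringing $\alpha$ to one of the following normal forms, or to one obtained from these by a permutation of the indices $1,2,3$ (applied simultaneously to the sequence and to the elements). Here $q=k+3p$, $p\ge0$; $\gamma=(213)^{2p}(21)^{2k}$ with $k>0$; $\beta=(213)^{2p}(21)^{2k+1}$ with $k\ge0$; in the lines for $1(21)^{2k}$ and $1(21)^{2k+1}$, $k\ge0$. In every line $g_{\alpha0}=e_\alpha h_\alpha$. | $\alpha$ | $f_\alpha$ | $e_\alpha$ | $h_\alpha$ | |---|---|---|---| | $\gamma$ | $y_1y_2a^{13}_qA^{32}_{k-1}$ | $y_2A^{32}_{k-1}a^{21}_qA^{13}_ka^{13}_q$ | $x_1+a^{32}_qA^{32}_k$ | | $3\gamma$ | $y_3(x_1+x_2)A^{23}_qa^{31}_{k-1}$ | $y_3a^{31}_{k-1}A^{12}_{q+1}a^{12}_kA^{23}_q$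 | $y_2y_3+A^{12}_qa^{31}_k$ | | $13\gamma$ | $y_3y_1a^{32}_{q+1}A^{21}_{k-1}$ | $y_1A^{21}_{k-1}a^{13}_{q+1}A^{32}_ka^{32}_{q+1}$ | $x_3+a^{21}_{q+1}A^{21}_k$ | | $(213)\gamma$ | $y_2(x_3+x_1)A^{12}_{q+1}a^{23}_{k-1}$ | $y_2a^{23}_{k-1}A^{31}_{q+2}a^{31}_kA^{12}_{q+1}$ | $y_1y_2+A^{31}_{q+1}a^{23}_k$ | | $3(213)\gamma$ | $y_2y_3a^{21}_{q+2}A^{13}_{k-1}$ | $y_3A^{13}_{k-1}a^{32}_{q+2}A^{21}_ka^{21}_{q+2}$ | $x_2+a^{13}_{q+2}A^{13}_k$ | | $13(213)\gamma$ | $y_1(x_2+x_3)A^{31}_{q+2}a^{12}_{k-1}$ | $y_1a^{12}_{k-1}A^{23}_{q+3}a^{23}_kA^{31}_{q+2}$ | $y_1y_3+A^{23}_{q+2}a^{12}_k$ | | $1(21)^{2k}$ | $x_1A^{23}_ka^{23}_k$ | $y_1A^{31}_ka^{12}_kA^{23}_ka^{23}_k$ | $y_2a^{21}_k+y_3a^{31}_k$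 | | $1(21)^{2k+1}$ | $y_1(x_2+x_3)A^{31}_ka^{12}_k$ | $y_1A^{31}_ka^{12}_kA^{23}_{k+1}a^{23}_{k+1}$ | $y_1a^{12}_{k+1}+y_1a^{13}_{k+1}$ | | $\beta$ | $y_2y_3a^{21}_qA^{13}_k$ | $y_2A^{32}_ka^{21}_qA^{13}_ka^{13}_{q+1}$ | $x_2+a^{13}_qA^{13}_{k+1}$ | | $3\beta$ | $x_3A^{12}_{q+1}a^{12}_k$ | $y_3a^{31}_kA^{12}_{q+1}a^{12}_kA^{23}_{q+1}$ | $y_1y_3+A^{23}_qa^{12}_{k+1}$ | | $13\beta$ | $y_1y_2a^{13}_{q+1}A^{32}_k$ | $y_1A^{21}_ka^{13}_{q+1}A^{32}_ka^{32}_{q+2}$ | $x_1+a^{32}_{q+1}A^{32}_{k+1}$ | | $(213)\beta$ | $x_2A^{31}_{q+2}a^{31}_k$ | $y_2a^{23}_kA^{31}_{q+2}a^{31}_kA^{12}_{q+2}$ | $y_2y_3+A^{12}_{q+1}a^{31}_{k+1}$ | | $3(213)\beta$ | $y_3y_1a^{32}_{q+2}A^{21}_k$ | $y_3A^{13}_ka^{32}_{q+2}A^{21}_ka^{21}_{q+3}$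 | $x_3+a^{21}_{q+2}A^{21}_{k+1}$ | | $13(213)\beta$ | $x_1A^{23}_{q+3}a^{23}_k$ | $y_1a^{12}_kA^{23}_{q+3}a^{23}_kA^{31}_{q+3}$ | $y_1y_2+A^{31}_{q+2}a^{23}_{k+1}$ | Moreover $g_0=I$. **Cumulative polynomials.** For $n\ge1$ and $t=1,2,3$ let $$x_t(n)=\sum f_{i_n\dots i_2t},\qquad y_t(n)=\sum e_{i_n\dots i_2t},\qquad x_0(n)=\sum g_{i_n\dots i_20},$$ where the first two sums run over the admissible sequences of length $n$ that start at $t$, and the third over all admissible sequences $i_n\dots i_2$ of length $n-1$ (so $x_0(1)=g_0=I$). **Proposition.** Let $\rho$ be a representation of $D^{2,2,2}$, let $n\ge1$, and let $z_t(n)$ be one of the cumulative polynomials $x_t(n)$, $y_t(n)$ ($t=1,2,3$) or $x_0(n)$. Then $$\sum_{i=1,2,3}\varphi_i\bigl(\Phi^+\rho(z_t(n))\bigr)=\rho(z_t(n+1)).$$ -/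

import Mathlib

/-! Indices `1, 2, 3` of the generators are represented by the elements `0, 1, 2` of `Fin 3`.
Sum and intersection in a lattice are `⊔` and `⊓`, the unity `I` is `⊤`. -/

namespace D222

/-! ### The modular lattice `D^{2,2,2}` -/

/-- Lattice polynomials in `x₁, x₂, x₃, y₁, y₂, y₃` and the unity. -/
inductive Term : Type
  | x : Fin 3 → Term
  | y : Fin 3 → Term
  | top : Term
  | sup : Term → Term → Term
  | inf : Term → Term → Term

/-- The smallest preorder on lattice polynomials that makes the quotient a modular lattice with
unity in which `xᵢ ≤ yᵢ`. -/
inductive Le : Term → Term → Prop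
  | refl (a : Term) : Le a a
  | trans {a b c : Term} : Le a b → Le b c → Le a c
  | gen (i : Fin 3) : Le (Term.x i) (Term.y i)
  | top (a : Term) : Le a Term.top
  | sup_left (a b : Term) : Le a (Term.sup a b)
  | sup_right (a b : Term) : Le b (Term.sup a b)
  | sup_le {a b c : Term} : Le a c → Le b c → Le (Term.sup a b) c
  | inf_left (a b : Term) : Le (Term.inf a b) a
  | inf_right (a b : Term) : Le (Term.inf a b) b
  | le_inf {a b c : Term} : Le a b → Le a c → Le a (Term.inf b c)
  | modular {a b : Term} (c : Term) : Le a b →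
      Le (Term.inf (Term.sup a c) b) (Term.sup a (Term.inf c b))

instance termSetoid : Setoid Term where
  r a b := Le a b ∧ Le b a
  iseqv :=
    { refl := fun a => ⟨Le.refl a, Le.refl a⟩
      symm := fun h => ⟨h.2, h.1⟩
      trans := fun h k => ⟨h.1.trans k.1, k.2.trans h.2⟩ }

end D222

/-- The modular lattice `D^{2,2,2}` with unity, generated by `xᵢ ≤ yᵢ` (`i = 1, 2, 3`) and subject
to no other relations. -/
def D222 : Type := Quotient D222.termSetoid

namespace D222

instance : LE D222 where
  le := Quotient.lift₂ Le (fun _ _ _ _ h k =>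
    propext ⟨fun l => (h.2.trans l).trans k.1, fun l => (h.1.trans l).trans k.2⟩)

instance : Lattice D222 where
  le_refl := by rintro ⟨a⟩; exact Le.refl a
  le_trans := by rintro ⟨a⟩ ⟨b⟩ ⟨c⟩ h k; exact Le.trans h k
  le_antisymm := by rintro ⟨a⟩ ⟨b⟩ h k; exact Quotient.sound ⟨h, k⟩
  sup := Quotient.map₂ Term.sup (fun _ _ h _ _ k =>
    ⟨Le.sup_le (h.1.trans (Le.sup_left _ _)) (k.1.trans (Le.sup_right _ _)),
     Le.sup_le (h.2.trans (Le.sup_left _ _)) (k.2.trans (Le.sup_right _ _))⟩)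
  le_sup_left := by rintro ⟨a⟩ ⟨b⟩; exact Le.sup_left a b
  le_sup_right := by rintro ⟨a⟩ ⟨b⟩; exact Le.sup_right a b
  sup_le := by rintro ⟨a⟩ ⟨b⟩ ⟨c⟩ h k; exact Le.sup_le h k
  inf := Quotient.map₂ Term.inf (fun _ _ h _ _ k =>
    ⟨Le.le_inf ((Le.inf_left _ _).trans h.1) ((Le.inf_right _ _).trans k.1),
     Le.le_inf ((Le.inf_left _ _).trans h.2) ((Le.inf_right _ _).trans k.2)⟩)
  inf_le_left := by rintro ⟨a⟩ ⟨b⟩; exact Le.inf_left a b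
  inf_le_right := by rintro ⟨a⟩ ⟨b⟩; exact Le.inf_right a b
  le_inf := by rintro ⟨a⟩ ⟨b⟩ ⟨c⟩ h k; exact Le.le_inf h k

instance : OrderTop D222 where
  top := Quotient.mk _ Term.top
  le_top := by rintro ⟨a⟩; exact Le.top a

instance : IsModularLattice D222 where
  sup_inf_le_assoc_of_le := by rintro ⟨a⟩ ⟨b⟩ ⟨c⟩ h; exact Le.modular b h

/-- The generator `xᵢ`. -/
def x (i : Fin 3) : D222 := Quotient.mk _ (Term.x i)

/-- The generator `yᵢ`. -/
def y (i : Fin 3) : D222 := Quotient.mk _ (Term.y i)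

theorem x_le_y (i : Fin 3) : x i ≤ y i := Le.gen i

section lift

variable {L : Type*} [Lattice L] [OrderTop L]

/-- The value of a lattice polynomial at given elements of a lattice. -/
def Term.eval (X Y : Fin 3 → L) : Term → L
  | Term.x i => X i
  | Term.y i => Y i
  | Term.top => ⊤
  | Term.sup a b => a.eval X Y ⊔ b.eval X Y
  | Term.inf a b => a.eval X Y ⊓ b.eval X Y

theorem Le.eval_le [IsModularLattice L] {X Y : Fin 3 → L} (h : ∀ i, X i ≤ Y i) {a b : Term}
    (l : Le a b) : a.eval X Y ≤ b.eval X Y := by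
  induction l with
  | refl a => exact le_rfl
  | trans _ _ h1 h2 => exact h1.trans h2
  | gen i => exact h i
  | top a => exact le_top
  | sup_left a b => exact le_sup_left
  | sup_right a b => exact le_sup_right
  | sup_le _ _ h1 h2 => exact _root_.sup_le h1 h2
  | inf_left a b => exact inf_le_left
  | inf_right a b => exact inf_le_right
  | le_inf _ _ h1 h2 => exact _root_.le_inf h1 h2
  | modular c _ h1 => exact IsModularLattice.sup_inf_le_assoc_of_le _ h1

/-- The lattice morphism from `D^{2,2,2}` to a modular lattice with prescribed images
`X i ≤ Y i` of the generators `xᵢ ≤ yᵢ`, preserving the unity. -/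
def lift [IsModularLattice L] (X Y : Fin 3 → L) (h : ∀ i, X i ≤ Y i) : LatticeHom D222 L where
  toFun := Quotient.lift (Term.eval X Y)
    (fun _ _ k => le_antisymm (k.1.eval_le h) (k.2.eval_le h))
  map_sup' := by rintro ⟨a⟩ ⟨b⟩; rfl
  map_inf' := by rintro ⟨a⟩ ⟨b⟩; rfl

end lift

/-! ### Linear representations, the Coxeter functor and the elementary maps -/

/-- A linear representation of `D^{2,2,2}` in the space `V`: a lattice morphism to the lattice of
linear subspaces of `V` sending the unity to `V`. -/
structure Representation (K V : Type*) [Field K] [AddCommGroup V] [Module K V] where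
  toHom : LatticeHom D222 (Submodule K V)
  map_top : toHom ⊤ = ⊤

namespace Representation

variable {K V : Type*} [Field K] [AddCommGroup V] [Module K V] (ρ : Representation K V)

instance : CoeFun (Representation K V) (fun _ => D222 → Submodule K V) where
  coe ρ := ρ.toHom

/-- The space `X₀¹ = {(η₁, η₂, η₃) | ηᵢ ∈ Yᵢ, η₁ + η₂ + η₃ = 0}`, where `Yᵢ = ρ(yᵢ)`. -/
def coxeterSpace : Submodule K (Fin 3 → V) where
  carrier := {η | (∀ i, η i ∈ ρ (y i)) ∧ ∑ i, η i = 0}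
  add_mem' := by
    rintro a b ⟨ha, ha'⟩ ⟨hb, hb'⟩
    exact ⟨fun i => add_mem (ha i) (hb i), by simp [Finset.sum_add_distrib, ha', hb']⟩
  zero_mem' := ⟨fun i => zero_mem _, by simp⟩
  smul_mem' := by
    rintro c a ⟨ha, ha'⟩
    exact ⟨fun i => Submodule.smul_mem _ c (ha i), by simp [← Finset.smul_sum, ha']⟩

/-- The elementary linear map `φᵢ : X₀¹ → X₀`, `(η₁, η₂, η₃) ↦ ηᵢ`. -/
def phi (i : Fin 3) : ρ.coxeterSpace →ₗ[K] V :=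
  (LinearMap.proj i).comp ρ.coxeterSpace.subtype

/-- The representation `Φ⁺ρ` in the space `X₀¹`, with
`Φ⁺ρ(xᵢ) = Xᵢ¹ = {η ∈ X₀¹ | ηᵢ = 0}` and `Φ⁺ρ(yᵢ) = Yᵢ¹ = {η ∈ X₀¹ | ηᵢ ∈ Xᵢ}`, where
`Xᵢ = ρ(xᵢ)`. -/
def coxeter : Representation K ρ.coxeterSpace where
  toHom := lift (fun i => Submodule.comap (ρ.phi i) ⊥) (fun i => Submodule.comap (ρ.phi i) (ρ (x i)))
    (fun _ => Submodule.comap_mono bot_le)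
  map_top := rfl

end Representation

/-! ### Atomic elements -/

/-- The index `k` with `{i, j, k} = {1, 2, 3}`, for `i ≠ j`. -/
def third (i j : Fin 3) : Fin 3 := -(i + j)

/-- The atomic elements: `a n i j` is `a_n^{ij}`, with `a_0^{ij} = I` and
`a_n^{ij} = x_i + y_j a_{n-1}^{jk}`. -/
def a : ℕ → Fin 3 → Fin 3 → D222
  | 0, _, _ => ⊤
  | n + 1, i, j => x i ⊔ y j ⊓ a n j (third i j)

/-- The atomic elements: `A n i j` is `A_n^{ij}`, with `A_0^{ij} = I` and
`A_n^{ij} = y_i + x_j A_{n-1}^{ki}`. -/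
def A : ℕ → Fin 3 → Fin 3 → D222
  | 0, _, _ => ⊤
  | n + 1, i, j => y i ⊔ x j ⊓ A n (third i j) i

/-! ### Admissible sequences

A sequence `i_n … i_2 i_1` is the list `[i_n, …, i_2, i_1]`: it starts at its last entry `i_1`. -/

/-- Adjacent indices are distinct. -/
def IsAdmissible (α : List (Fin 3)) : Prop := α.IsChain (· ≠ ·)

/-- Replacing a subsequence `iji` by `iki`, where `i, j, k` are distinct. -/
inductive Replace : List (Fin 3) → List (Fin 3) → Prop
  | mk (l r : List (Fin 3)) (i j k : Fin 3) (hij : i ≠ j) (hik : i ≠ k) (hjk : j ≠ k) :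
      Replace (l ++ i :: j :: i :: r) (l ++ i :: k :: i :: r)

/-- Two sequences are identified if they are connected by replacements `iji = iki`. -/
def SeqEquiv : List (Fin 3) → List (Fin 3) → Prop := Relation.EqvGen Replace

/-- `power s m` is the sequence `s^m`. -/
def power (s : List (Fin 3)) (m : ℕ) : List (Fin 3) := (List.replicate m s).flatten

/-! ### Admissible elements -/

/-- An admissible sequence `α` together with the elements `f_α`, `e_α`, `g_{α0}`. -/
structure AdmissibleData where
  α : List (Fin 3)
  f : D222
  e : D222
  g : D222

/-- Auxiliary constructor: `g_{α0}` is always of the form `e_α · h`. -/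
def AdmissibleData.of (α : List (Fin 3)) (f e h : D222) : AdmissibleData := ⟨α, f, e, e ⊓ h⟩

/-- The table of the admissible elements, in normal form, whose sequence starts at `u`. The
indices `u, v, w` are a permutation of `1, 2, 3` (for `u, v, w = 1, 2, 3` the sequences are built
from `213` and `21`; the others are obtained by permuting indices). The columns are `α`, `f_α`,
`e_α`, `h` with `g_{α0} = e_α h`. -/
def table (u v w : Fin 3) (k p : ℕ) : Fin 14 → AdmissibleData :=
  let q := k + 3 * p
  let γ := power [v, u, w] (2 * p) ++ power [v, u] (2 * k)
  let β := power [v, u, w] (2 * p) ++ power [v, u] (2 * k + 1)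
  ![.of γ
      (y u ⊓ y v ⊓ a q u w ⊓ A (k - 1) w v)
      (y v ⊓ A (k - 1) w v ⊓ a q v u ⊓ A k u w ⊓ a q u w)
      (x u ⊔ a q w v ⊓ A k w v),
    .of ([w] ++ γ)
      (y w ⊓ (x u ⊔ x v) ⊓ A q v w ⊓ a (k - 1) w u)
      (y w ⊓ a (k - 1) w u ⊓ A (q + 1) u v ⊓ a k u v ⊓ A q v w)
      (y v ⊓ y w ⊔ A q u v ⊓ a k w u),
    .of ([u, w] ++ γ)
      (y w ⊓ y u ⊓ a (q + 1) w v ⊓ A (k - 1) v u)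
      (y u ⊓ A (k - 1) v u ⊓ a (q + 1) u w ⊓ A k w v ⊓ a (q + 1) w v)
      (x w ⊔ a (q + 1) v u ⊓ A k v u),
    .of ([v, u, w] ++ γ)
      (y v ⊓ (x w ⊔ x u) ⊓ A (q + 1) u v ⊓ a (k - 1) v w)
      (y v ⊓ a (k - 1) v w ⊓ A (q + 2) w u ⊓ a k w u ⊓ A (q + 1) u v)
      (y u ⊓ y v ⊔ A (q + 1) w u ⊓ a k v w),
    .of ([w, v, u, w] ++ γ)
      (y v ⊓ y w ⊓ a (q + 2) v u ⊓ A (k - 1) u w)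
      (y w ⊓ A (k - 1) u w ⊓ a (q + 2) w v ⊓ A k v u ⊓ a (q + 2) v u)
      (x v ⊔ a (q + 2) u w ⊓ A k u w),
    .of ([u, w, v, u, w] ++ γ)
      (y u ⊓ (x v ⊔ x w) ⊓ A (q + 2) w u ⊓ a (k - 1) u v)
      (y u ⊓ a (k - 1) u v ⊓ A (q + 3) v w ⊓ a k v w ⊓ A (q + 2) w u)
      (y u ⊓ y w ⊔ A (q + 2) v w ⊓ a k u v),
    .of ([u] ++ power [v, u] (2 * k))
      (x u ⊓ A k v w ⊓ a k v w)
      (y u ⊓ A k w u ⊓ a k u v ⊓ A k v w ⊓ a k v w)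
      (y v ⊓ a k v u ⊔ y w ⊓ a k w u),
    .of ([u] ++ power [v, u] (2 * k + 1))
      (y u ⊓ (x v ⊔ x w) ⊓ A k w u ⊓ a k u v)
      (y u ⊓ A k w u ⊓ a k u v ⊓ A (k + 1) v w ⊓ a (k + 1) v w)
      (y u ⊓ a (k + 1) u v ⊔ y u ⊓ a (k + 1) u w),
    .of β
      (y v ⊓ y w ⊓ a q v u ⊓ A k u w)
      (y v ⊓ A k w v ⊓ a q v u ⊓ A k u w ⊓ a (q + 1) u w)
      (x v ⊔ a q u w ⊓ A (k + 1) u w),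
    .of ([w] ++ β)
      (x w ⊓ A (q + 1) u v ⊓ a k u v)
      (y w ⊓ a k w u ⊓ A (q + 1) u v ⊓ a k u v ⊓ A (q + 1) v w)
      (y u ⊓ y w ⊔ A q v w ⊓ a (k + 1) u v),
    .of ([u, w] ++ β)
      (y u ⊓ y v ⊓ a (q + 1) u w ⊓ A k w v)
      (y u ⊓ A k v u ⊓ a (q + 1) u w ⊓ A k w v ⊓ a (q + 2) w v)
      (x u ⊔ a (q + 1) w v ⊓ A (k + 1) w v),
    .of ([v, u, w] ++ β)
      (x v ⊓ A (q + 2) w u ⊓ a k w u)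
      (y v ⊓ a k v w ⊓ A (q + 2) w u ⊓ a k w u ⊓ A (q + 2) u v)
      (y v ⊓ y w ⊔ A (q + 1) u v ⊓ a (k + 1) w u),
    .of ([w, v, u, w] ++ β)
      (y w ⊓ y u ⊓ a (q + 2) w v ⊓ A k v u)
      (y w ⊓ A k u w ⊓ a (q + 2) w v ⊓ A k v u ⊓ a (q + 3) v u)
      (x w ⊔ a (q + 2) v u ⊓ A (k + 1) v u),
    .of ([u, w, v, u, w] ++ β)
      (x u ⊓ A (q + 3) v w ⊓ a k v w)
      (y u ⊓ a k u v ⊓ A (q + 3) v w ⊓ a k v w ⊓ A (q + 3) w u)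
      (y u ⊓ y v ⊔ A (q + 2) w u ⊓ a (k + 1) v w)]

/-- `TableEntry d`: `d` is one of the entries of the table. In the first six lines `k > 0`;
lines seven and eight do not involve `p`. -/
def TableEntry (d : AdmissibleData) : Prop :=
  ∃ (σ : Equiv.Perm (Fin 3)) (k p : ℕ) (N : Fin 14),
    ((N : ℕ) < 6 → 0 < k) ∧ ((N : ℕ) = 6 ∨ (N : ℕ) = 7 → p = 0) ∧
    d = table (σ 0) (σ 1) (σ 2) k p N

/-- `AdmissibleElements α f e g`: the sequence `α` is admissible and `f = f_α`, `e = e_α`,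
`g = g_{α0}`, read off from the table after bringing `α` to normal form. -/
def AdmissibleElements (α : List (Fin 3)) (f e g : D222) : Prop :=
  IsAdmissible α ∧ ∃ d, TableEntry d ∧ SeqEquiv α d.α ∧ f = d.f ∧ e = d.e ∧ g = d.g

/-! ### Cumulative polynomials -/

/-- The elements `f_{i_n … i_2 t}`. -/
def fSet (t : Fin 3) (n : ℕ) : Set D222 :=
  {f | ∃ α e g, AdmissibleElements α f e g ∧ α.length = n ∧ α.getLast? = some t}

/-- The elements `e_{i_n … i_2 t}`. -/
def eSet (t : Fin 3) (n : ℕ) : Set D222 :=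
  {e | ∃ α f g, AdmissibleElements α f e g ∧ α.length = n ∧ α.getLast? = some t}

/-- The elements `g_{i_n … i_2 0}`; for `n = 1` this is only `g_0 = I`. -/
def gSet (n : ℕ) : Set D222 :=
  {g | (n = 1 ∧ g = ⊤) ∨ ∃ α f e, AdmissibleElements α f e g ∧ α.length + 1 = n}

theorem SeqEquiv.length_eq {α β : List (Fin 3)} (h : SeqEquiv α β) : α.length = β.length := by
  induction h with
  | rel _ _ h => cases h; simp
  | refl => rfl
  | symm _ _ _ h => exact h.symm
  | trans _ _ _ _ _ h k => exact h.trans k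

theorem length_power (s : List (Fin 3)) (m : ℕ) : (power s m).length = m * s.length := by
  simp [power]

theorem exists_table_α (u v w : Fin 3) (k p : ℕ) (N : Fin 14)
    (hp : (N : ℕ) = 6 ∨ (N : ℕ) = 7 → p = 0) :
    ∃ l r q, p ≤ q ∧ k ≤ r ∧
      (table u v w k p N).α = l ++ (power [v, u, w] q ++ power [v, u] r) := by
  match N, hp with
  | 0, _ => exact ⟨[], 2 * k, 2 * p, by omega, by omega, rfl⟩
  | 1, _ => exact ⟨[w], 2 * k, 2 * p, by omega, by omega, rfl⟩
  | 2, _ => exact ⟨[u, w], 2 * k, 2 * p, by omega, by omega, rfl⟩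
  | 3, _ => exact ⟨[v, u, w], 2 * k, 2 * p, by omega, by omega, rfl⟩
  | 4, _ => exact ⟨[w, v, u, w], 2 * k, 2 * p, by omega, by omega, rfl⟩
  | 5, _ => exact ⟨[u, w, v, u, w], 2 * k, 2 * p, by omega, by omega, rfl⟩
  | 6, h => exact ⟨[u], 2 * k, 0, (h (Or.inl rfl)).le, by omega, rfl⟩
  | 7, h => exact ⟨[u], 2 * k + 1, 0, (h (Or.inr rfl)).le, by omega, rfl⟩
  | 8, _ => exact ⟨[], 2 * k + 1, 2 * p, by omega, by omega, rfl⟩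
  | 9, _ => exact ⟨[w], 2 * k + 1, 2 * p, by omega, by omega, rfl⟩
  | 10, _ => exact ⟨[u, w], 2 * k + 1, 2 * p, by omega, by omega, rfl⟩
  | 11, _ => exact ⟨[v, u, w], 2 * k + 1, 2 * p, by omega, by omega, rfl⟩
  | 12, _ => exact ⟨[w, v, u, w], 2 * k + 1, 2 * p, by omega, by omega, rfl⟩
  | 13, _ => exact ⟨[u, w, v, u, w], 2 * k + 1, 2 * p, by omega, by omega, rfl⟩

theorem finite_tableEntry (n : ℕ) : {d | TableEntry d ∧ d.α.length = n}.Finite := by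
  have h : (Set.range fun z : Equiv.Perm (Fin 3) × Fin (n + 1) × Fin (n + 1) × Fin 14 =>
      table (z.1 0) (z.1 1) (z.1 2) z.2.1 z.2.2.1 z.2.2.2).Finite := Set.finite_range _
  refine h.subset ?_
  rintro d ⟨⟨σ, k, p, N, -, hp, rfl⟩, hn⟩
  obtain ⟨l, r, q, hq, hr, hα⟩ := exists_table_α (σ 0) (σ 1) (σ 2) k p N hp
  have hb : k < n + 1 ∧ p < n + 1 := by
    rw [hα] at hn
    simp only [List.length_append, length_power, List.length_cons, List.length_nil] at hn
    omega
  exact ⟨(σ, ⟨k, hb.1⟩, ⟨p, hb.2⟩, N), rfl⟩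

theorem finite_fSet (t : Fin 3) (n : ℕ) : (fSet t n).Finite := by
  refine ((finite_tableEntry n).image AdmissibleData.f).subset ?_
  rintro f ⟨α, e, g, ⟨-, d, hd, hα, hf, -, -⟩, hn, -⟩
  exact ⟨d, ⟨hd, hα.length_eq ▸ hn⟩, hf.symm⟩

theorem finite_eSet (t : Fin 3) (n : ℕ) : (eSet t n).Finite := by
  refine ((finite_tableEntry n).image AdmissibleData.e).subset ?_
  rintro e ⟨α, f, g, ⟨-, d, hd, hα, -, he, -⟩, hn, -⟩
  exact ⟨d, ⟨hd, hα.length_eq ▸ hn⟩, he.symm⟩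

theorem finite_gSet (n : ℕ) : (gSet n).Finite := by
  refine (((finite_tableEntry (n - 1)).image AdmissibleData.g).union
    (Set.finite_singleton ⊤)).subset ?_
  rintro g (⟨-, rfl⟩ | ⟨α, f, e, ⟨-, d, hd, hα, -, -, hg⟩, hn⟩)
  · exact Or.inr rfl
  · refine Or.inl ⟨d, ⟨hd, ?_⟩, hg.symm⟩
    rw [← hα.length_eq]; omega

theorem isChain_power {u v : Fin 3} (h : u ≠ v) (m : ℕ) :
    (u :: power [v, u] m).IsChain (· ≠ ·) := by
  induction m with
  | zero => simp [power]
  | succ m ih =>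
    have : u :: power [v, u] (m + 1) = u :: v :: u :: power [v, u] m := by
      simp [power, List.replicate_succ]
    rw [this]
    exact List.isChain_cons_cons.2 ⟨h, List.isChain_cons_cons.2 ⟨h.symm, ih⟩⟩

theorem getLast_power (u v : Fin 3) (m : ℕ) :
    (u :: power [v, u] m).getLast? = some u := by
  induction m with
  | zero => simp [power]
  | succ m ih =>
    have : u :: power [v, u] (m + 1) = u :: v :: (u :: power [v, u] m) := by
      simp [power, List.replicate_succ]
    rw [this, List.getLast?_cons_cons, List.getLast?_cons_cons, ih]

theorem exists_admissibleElements (t : Fin 3) {n : ℕ} (hn : 1 ≤ n) :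
    ∃ α f e g, AdmissibleElements α f e g ∧ α.length = n ∧ α.getLast? = some t := by
  obtain ⟨σ, rfl⟩ : ∃ σ : Equiv.Perm (Fin 3), σ 0 = t := ⟨Equiv.swap 0 t, by simp⟩
  have huv : σ 0 ≠ σ 1 := fun h => by simpa using σ.injective h
  suffices H : ∃ d, TableEntry d ∧ IsAdmissible d.α ∧ d.α.length = n ∧
      d.α.getLast? = some (σ 0) by
    obtain ⟨d, h1, h2, h3, h4⟩ := H
    exact ⟨d.α, d.f, d.e, d.g, ⟨h2, d, h1, Relation.EqvGen.refl _, rfl, rfl, rfl⟩, h3, h4⟩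
  have key : ∀ m, power [σ 1, σ 0] (m + 1) = σ 1 :: σ 0 :: power [σ 1, σ 0] m := fun m => by
    simp [power, List.replicate_succ]
  have hz : ∀ s, power s 0 = [] := fun s => rfl
  obtain ⟨k, hk⟩ : ∃ k, n = 4 * k + 1 ∨ n = 4 * k + 2 ∨ n = 4 * k + 3 ∨ n = 4 * k + 4 :=
    ⟨(n - 1) / 4, by omega⟩
  rcases hk with rfl | rfl | rfl | rfl
  · refine ⟨_, ⟨σ, k, 0, 6, by simp, by simp, rfl⟩, ?_⟩
    refine ⟨isChain_power huv (2 * k), ?_, getLast_power _ _ (2 * k)⟩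
    simp [table, AdmissibleData.of, length_power]; omega
  · refine ⟨_, ⟨σ, k, 0, 8, by simp, by simp, rfl⟩, ?_⟩
    have h : (table (σ 0) (σ 1) (σ 2) k 0 8).α = σ 1 :: σ 0 :: power [σ 1, σ 0] (2 * k) :=
      key (2 * k)
    rw [h, List.getLast?_cons_cons]
    refine ⟨List.isChain_cons_cons.2 ⟨huv.symm, isChain_power huv (2 * k)⟩, ?_,
      getLast_power _ _ (2 * k)⟩
    simp [length_power]; omega
  · refine ⟨_, ⟨σ, k, 0, 7, by simp, by simp, rfl⟩, ?_⟩
    refine ⟨isChain_power huv (2 * k + 1), ?_, getLast_power _ _ (2 * k + 1)⟩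
    simp [table, AdmissibleData.of, length_power]; omega
  · refine ⟨_, ⟨σ, k + 1, 0, 0, by simp, by simp, rfl⟩, ?_⟩
    have h : (table (σ 0) (σ 1) (σ 2) (k + 1) 0 0).α
        = σ 1 :: σ 0 :: power [σ 1, σ 0] (2 * k + 1) :=
      key (2 * k + 1)
    rw [h, List.getLast?_cons_cons]
    refine ⟨List.isChain_cons_cons.2 ⟨huv.symm, isChain_power huv (2 * k + 1)⟩, ?_,
      getLast_power _ _ (2 * k + 1)⟩
    simp [length_power]; omega

theorem nonempty_fSet (t : Fin 3) {n : ℕ} (hn : 1 ≤ n) : (fSet t n).Nonempty := by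
  obtain ⟨α, f, e, g, h⟩ := exists_admissibleElements t hn
  exact ⟨f, α, e, g, h⟩

theorem nonempty_eSet (t : Fin 3) {n : ℕ} (hn : 1 ≤ n) : (eSet t n).Nonempty := by
  obtain ⟨α, f, e, g, h⟩ := exists_admissibleElements t hn
  exact ⟨e, α, f, g, h⟩

theorem nonempty_gSet {n : ℕ} (hn : 1 ≤ n) : (gSet n).Nonempty := by
  rcases Nat.lt_or_ge 1 n with h1 | h1
  · obtain ⟨α, f, e, g, h, hl, -⟩ := exists_admissibleElements 0 (n := n - 1) (by omega)
    exact ⟨g, Or.inr ⟨α, f, e, h, by omega⟩⟩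
  · exact ⟨⊤, Or.inl ⟨by omega, rfl⟩⟩

/-- The sum (join) of a finite non-empty set of elements. -/
noncomputable def sum (S : Set D222) (hS : S.Finite) (hne : S.Nonempty) : D222 :=
  hS.toFinset.sup' (hS.toFinset_nonempty.2 hne) id

/-- The cumulative polynomial `x_t(n) = ∑ f_{i_n … i_2 t}`, for `n ≥ 1`. -/
noncomputable def cumX (t : Fin 3) (n : ℕ) (hn : 1 ≤ n) : D222 :=
  sum (fSet t n) (finite_fSet t n) (nonempty_fSet t hn)

/-- The cumulative polynomial `y_t(n) = ∑ e_{i_n … i_2 t}`, for `n ≥ 1`. -/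
noncomputable def cumY (t : Fin 3) (n : ℕ) (hn : 1 ≤ n) : D222 :=
  sum (eSet t n) (finite_eSet t n) (nonempty_eSet t hn)

/-- The cumulative polynomial `x_0(n) = ∑ g_{i_n … i_2 0}`, for `n ≥ 1`. -/
noncomputable def cumX0 (n : ℕ) (hn : 1 ≤ n) : D222 :=
  sum (gSet n) (finite_gSet n) (nonempty_gSet hn)

end D222

universe v

namespace D222

/-! Write iα for α with the index i put in front. The core is a one-step rule: φᵢ(Φ⁺ρ(z_α)) =
ρ(z_{iα}) for z = f, e, g and both i different from the front index of α. The third map adds nothing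
to the sum, because φ₁ + φ₂ + φ₃ = 0 puts its image inside the sum of the other two
(`map_phi_le_sup`). Conversely, every summand of length n + 1 comes from one of length n, so the
sums match. The step from x₀(1) = I is separate: φᵢ(X₀¹) = Yᵢ ∩ (Yⱼ + Yₖ).

For the one-step rule, Φ⁺ turns an atomic element into a condition on a single coordinate:
Φ⁺ρ(a_n^{ij}) = φᵢ⁻¹ρ(A_n^{kj}) and Φ⁺ρ(A_n^{ij}) = φᵢ⁻¹ρ(a_n^{ik}) (`coxeter_a_A`). Hence
admissible elements become boxes, with one condition per coordinate, whose images are given by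
`map_phi_box`. The modular law recombines these images into the next row of the table.

Up to cyclic shifts the table has four families, `gammaA`, `gammaB`, `betaA`, `betaB`, and two odd
rows, which are members of these families except for the one-term sequence. Six transitions are
computed directly. The other two, and the symmetry of the odd rows in their last two indices, follow
from φᵢφⱼφᵢ = -φᵢφₖφᵢ (`map_phi_phi_phi`), the linear counterpart of iji = iki.

Neither existence nor uniqueness of normal forms is needed: it suffices that the values attained at
a given length and starting index (`Level`) have successors and predecessors, and replacements
preserve both data. -/

/-- `i, j, k` are the three indices in some order. -/
def IsTriple (i j k : Fin 3) : Prop := i ≠ j ∧ i ≠ k ∧ j ≠ k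

theorem IsTriple.rotate {i j k : Fin 3} (h : IsTriple i j k) : IsTriple k i j :=
  ⟨h.2.1.symm, h.2.2.symm, h.1⟩

theorem IsTriple.swap {i j k : Fin 3} (h : IsTriple i j k) : IsTriple i k j :=
  ⟨h.2.1, h.1, h.2.2.symm⟩

theorem IsTriple.third_eq {i j k : Fin 3} (h : IsTriple i j k) : third i j = k := by
  revert i j k; unfold IsTriple; decide

theorem IsTriple.univ_eq {i j k : Fin 3} (h : IsTriple i j k) :
    (Finset.univ : Finset (Fin 3)) = {i, j, k} := by
  revert i j k; unfold IsTriple; decide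

theorem IsTriple.eq_or {i j k : Fin 3} (h : IsTriple i j k) (l : Fin 3) :
    l = i ∨ l = j ∨ l = k := by
  revert i j k l; unfold IsTriple; decide

theorem IsTriple.sum_eq {M : Type*} [AddCommMonoid M] {i j k : Fin 3} (h : IsTriple i j k)
    (f : Fin 3 → M) : ∑ l, f l = f i + f j + f k := by
  rw [h.univ_eq, Finset.sum_insert (by simp [h.1, h.2.1]), Finset.sum_pair h.2.2, add_assoc]

/-! ### Order relations between atomic elements -/

theorem a_zero (i j : Fin 3) : a 0 i j = ⊤ := rfl

theorem A_zero (i j : Fin 3) : A 0 i j = ⊤ := rfl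

theorem a_succ {i j k : Fin 3} (h : IsTriple i j k) (n : ℕ) :
    a (n + 1) i j = x i ⊔ y j ⊓ a n j k := by
  rw [a, h.third_eq]

theorem A_succ {i j k : Fin 3} (h : IsTriple i j k) (n : ℕ) :
    A (n + 1) i j = y i ⊔ x j ⊓ A n k i := by
  rw [A, h.third_eq]

theorem x_le_a (n : ℕ) (i j : Fin 3) : x i ≤ a n i j := by
  cases n
  · exact le_top
  · exact le_sup_left

theorem y_le_A (n : ℕ) (i j : Fin 3) : y i ≤ A n i j := by
  cases n
  · exact le_top
  · exact le_sup_left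

theorem x_le_A (n : ℕ) (i j : Fin 3) : x i ≤ A n i j := (x_le_y i).trans (y_le_A n i j)

theorem x_le_a' (n : ℕ) (i j : Fin 3) : x j ≤ a n i j := by
  cases n
  · exact le_top
  · exact (le_inf (x_le_y j) (x_le_a _ _ _)).trans le_sup_right

theorem a_succ_le (n : ℕ) (i j : Fin 3) : a (n + 1) i j ≤ a n i j := by
  induction n generalizing i j with
  | zero => exact le_top
  | succ n ih => exact sup_le_sup_left (inf_le_inf_left _ (ih _ _)) _

theorem A_succ_le (n : ℕ) (i j : Fin 3) : A (n + 1) i j ≤ A n i j := by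
  induction n generalizing i j with
  | zero => exact le_top
  | succ n ih => exact sup_le_sup_left (inf_le_inf_left _ (ih _ _)) _

section

variable {i j k : Fin 3}

theorem y_inf_a_le (h : IsTriple i j k) (n : ℕ) : y j ⊓ a n j k ≤ a (n + 1) i j :=
  (a_succ h n).symm ▸ le_sup_right

/-- The recursion for a_{n+1}, cut down by b with the modular law. This and the next identity turn
the sums in images of boxes back into products of atomic elements. -/
theorem x_inf_sup_y_inf_a (h : IsTriple i j k) (n : ℕ) {b : D222} (hb : y j ≤ b) :
    x i ⊓ b ⊔ y j ⊓ a n j k = b ⊓ a (n + 1) i j := by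
  rw [a_succ h, inf_comm b, sup_comm, sup_comm (x i), sup_inf_assoc_of_le]
  exact inf_le_left.trans hb

theorem x_inf_A_sup_y_inf (h : IsTriple i j k) (n : ℕ) {b : D222} (hb : x j ≤ b) :
    x j ⊓ A n k i ⊔ y i ⊓ b = A (n + 1) i j ⊓ b := by
  rw [A_succ h, sup_comm (y i), sup_inf_assoc_of_le]
  exact inf_le_left.trans hb

/-- Expand a_{n+1}^{ik} and use xᵢ ≤ yᵢ to move yᵢ onto the second summand. That summand lies below
A_n^{jk} by induction on the rotated triple; since yⱼ ≤ A_n^{jk}, the modular law then leaves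
xᵢA_n^{jk} as the other summand. -/
theorem y_inf_y_inf_a_le_A (h : IsTriple i j k) (n : ℕ) :
    y i ⊓ y j ⊓ a n i k ≤ A n k i := by
  induction n generalizing i j k with
  | zero => exact le_top
  | succ n ih =>
    have h1 : y i ⊓ y j ⊓ a (n + 1) i k ≤
        A n j k ⊓ (x i ⊔ y k ⊓ y i ⊓ a n k j) := by
      refine le_inf (inf_le_left.trans (inf_le_right.trans (y_le_A _ _ _))) ?_
      rw [a_succ h.swap, inf_right_comm (y k), ← sup_inf_assoc_of_le _ (x_le_y i), inf_comm]
      exact inf_le_inf_left _ inf_le_left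
    refine h1.trans ?_
    rw [A_succ h.rotate, inf_comm, sup_comm, sup_inf_assoc_of_le _ (ih h.rotate)]
    exact sup_le_sup (inf_le_left.trans inf_le_left) le_rfl

/-- At n = 0 this is A_1^{ij} = yᵢ + xⱼ = a_1^{ji}. In the step, yⱼyₖa_{n+1}^{ki} is enlarged until
it contains the summand xⱼA_{n+1}^{ki}; the modular law then leaves the rotated induction
hypothesis. -/
theorem y_inf_y_inf_a_inf_A_le_a (h : IsTriple i j k) (n : ℕ) :
    y j ⊓ y k ⊓ a n k i ⊓ A (n + 1) i j ≤ a (n + 1) j i := by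
  induction n generalizing i j k with
  | zero =>
    refine inf_le_right.trans ?_
    rw [A_succ h, a_succ h.swap.rotate, a_zero, A_zero, inf_top_eq, inf_top_eq, sup_comm]
  | succ n ih =>
    have h1 : y j ⊓ y k ⊓ a (n + 1) k i ≤ y j ⊓ a n j k ⊓ A (n + 1) k i := by
      refine le_inf (le_inf (inf_le_left.trans inf_le_left) ?_)
        (inf_le_left.trans (inf_le_right.trans (y_le_A _ _ _)))
      exact (inf_le_inf_right _ inf_le_right).trans
        ((y_inf_a_le h.rotate.rotate (n + 1)).trans
          ((a_succ_le _ _ _).trans (a_succ_le _ _ _)))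
    have h2 : x j ⊓ A (n + 1) k i ≤ y j ⊓ a n j k ⊓ A (n + 1) k i :=
      inf_le_inf_right _ (le_inf (x_le_y j) (x_le_a _ _ _))
    refine (inf_le_inf_right _ h1).trans ?_
    rw [A_succ h (n + 1), inf_comm, sup_comm, sup_inf_assoc_of_le _ h2,
      a_succ h.swap.rotate (n + 1)]
    refine sup_le_sup inf_le_left (le_inf inf_le_left ?_)
    rw [← inf_assoc, ← inf_assoc]
    exact ih h.rotate

end
-- Elementary maps, and Φ⁺ on atomic elements
theorem map_map_le_of_add_eq_zero {K U V W : Type*} [Field K] [AddCommGroup U] [Module K U]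
    [AddCommGroup V] [Module K V] [AddCommGroup W] [Module K W] {f f' : W →ₗ[K] U} {g : U →ₗ[K] V}
    {S : Submodule K W} (h : ∀ w ∈ S, g (f w) + g (f' w) = 0) :
    (S.map f).map g ≤ (S.map f').map g := by
  rintro _ ⟨_, ⟨w, hw, rfl⟩, rfl⟩
  refine ⟨_, ⟨-w, neg_mem hw, rfl⟩, ?_⟩
  rw [map_neg, map_neg]
  exact (eq_neg_of_add_eq_zero_left (h w hw)).symm

namespace Representation

variable {K V : Type*} [Field K] [AddCommGroup V] [Module K V] (ρ : Representation K V)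

theorem phi_mem (i : Fin 3) (η : ρ.coxeterSpace) : ρ.phi i η ∈ ρ (y i) := η.2.1 i

theorem phi_add {i j k : Fin 3} (h : IsTriple i j k) (η : ρ.coxeterSpace) :
    ρ.phi i η + ρ.phi j η + ρ.phi k η = 0 := by
  rw [← h.sum_eq (fun l => ρ.phi l η)]; exact η.2.2

theorem exists_phi_eq {i j k : Fin 3} (h : IsTriple i j k) {b c d : V} (hb : b ∈ ρ (y i))
    (hc : c ∈ ρ (y j)) (hd : d ∈ ρ (y k)) (hs : b + c + d = 0) :
    ∃ η : ρ.coxeterSpace, ρ.phi i η = b ∧ ρ.phi j η = c ∧ ρ.phi k η = d := by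
  let f : Fin 3 → V := fun l => if l = i then b else if l = j then c else d
  have fi : f i = b := by simp [f]
  have fj : f j = c := by simp [f, h.1.symm]
  have fk : f k = d := by simp [f, h.2.1.symm, h.2.2.symm]
  refine ⟨⟨f, fun l => ?_, ?_⟩, fi, fj, fk⟩
  · rcases h.eq_or l with rfl | rfl | rfl
    · rwa [fi]
    · rwa [fj]
    · rwa [fk]
  · rw [h.sum_eq, fi, fj, fk, hs]

theorem coxeter_x (i : Fin 3) : ρ.coxeter (x i) = Submodule.comap (ρ.phi i) ⊥ := rfl

theorem coxeter_y (i : Fin 3) : ρ.coxeter (y i) = Submodule.comap (ρ.phi i) (ρ (x i)) := rfl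

/-- The image under `φᵢ` of the subspace cut out by one condition on each coordinate. -/
theorem map_phi_box {i j k : Fin 3} (h : IsTriple i j k) (B C D : Submodule K V) :
    Submodule.map (ρ.phi i) (Submodule.comap (ρ.phi i) B ⊓ Submodule.comap (ρ.phi j) C ⊓
      Submodule.comap (ρ.phi k) D) = ρ (y i) ⊓ B ⊓ (ρ (y j) ⊓ C ⊔ ρ (y k) ⊓ D) := by
  ext b
  simp only [Submodule.mem_map, Submodule.mem_inf, Submodule.mem_comap, Submodule.mem_sup]
  constructor
  · rintro ⟨η, ⟨⟨h1, h2⟩, h3⟩, rfl⟩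
    refine ⟨⟨ρ.phi_mem i η, h1⟩, -ρ.phi j η, ⟨neg_mem (ρ.phi_mem j η), neg_mem h2⟩,
      -ρ.phi k η, ⟨neg_mem (ρ.phi_mem k η), neg_mem h3⟩, ?_⟩
    rw [eq_comm, ← sub_eq_zero, ← ρ.phi_add h η]; abel
  · rintro ⟨⟨h1, h2⟩, c, ⟨h3, h4⟩, d, ⟨h5, h6⟩, rfl⟩
    obtain ⟨η, e1, e2, e3⟩ := ρ.exists_phi_eq h h1 (neg_mem h3) (neg_mem h5) (by abel)
    exact ⟨η, ⟨⟨by rwa [e1], by rw [e2]; exact neg_mem h4⟩, by rw [e3]; exact neg_mem h6⟩, e1⟩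

/-- A subspace of the form `Xᵢ¹ + S` is the preimage of `φᵢ(S)`. -/
theorem coxeter_x_sup (i : Fin 3) (S : Submodule K ρ.coxeterSpace) :
    ρ.coxeter (x i) ⊔ S = Submodule.comap (ρ.phi i) (Submodule.map (ρ.phi i) S) := by
  rw [Submodule.comap_map_eq, sup_comm]; rfl

theorem coxeter_sup (b c : D222) : ρ.coxeter (b ⊔ c) = ρ.coxeter b ⊔ ρ.coxeter c :=
  map_sup ρ.coxeter.toHom b c

theorem coxeter_inf (b c : D222) : ρ.coxeter (b ⊓ c) = ρ.coxeter b ⊓ ρ.coxeter c :=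
  map_inf ρ.coxeter.toHom b c

theorem apply_sup (b c : D222) : ρ (b ⊔ c) = ρ b ⊔ ρ c := map_sup ρ.toHom b c

theorem apply_inf (b c : D222) : ρ (b ⊓ c) = ρ b ⊓ ρ c := map_inf ρ.toHom b c

theorem apply_mono {b c : D222} (h : b ≤ c) : ρ b ≤ ρ c := OrderHomClass.mono ρ.toHom h

theorem comap_phi_y_inf (i : Fin 3) (b : D222) :
    Submodule.comap (ρ.phi i) (ρ (y i ⊓ b)) = Submodule.comap (ρ.phi i) (ρ b) :=
  le_antisymm (Submodule.comap_mono (ρ.apply_mono inf_le_right))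
    fun η hη => by rw [apply_inf]; exact ⟨ρ.phi_mem i η, hη⟩

/-- ηᵢ = -(ηⱼ + ηₖ) always lies in Yⱼ + Yₖ, so this factor may be inserted or dropped under φᵢ⁻¹. -/
theorem comap_phi_inf_sup {i j k : Fin 3} (h : IsTriple i j k) (b : D222) :
    Submodule.comap (ρ.phi i) (ρ (b ⊓ (y j ⊔ y k))) = Submodule.comap (ρ.phi i) (ρ b) := by
  refine le_antisymm (Submodule.comap_mono (ρ.apply_mono inf_le_left)) fun η hη => ?_
  have := ρ.map_phi_box h ⊤ ⊤ ⊤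
  simp only [inf_top_eq, Submodule.comap_top] at this
  rw [apply_inf, apply_sup]
  exact ⟨hη, (this.le (Submodule.mem_map_of_mem (f := ρ.phi i) (Submodule.mem_top (x := η)))).2⟩

theorem map_phi_le_sup {i j k : Fin 3} (h : IsTriple i j k) (S : Submodule K ρ.coxeterSpace) :
    S.map (ρ.phi i) ≤ S.map (ρ.phi j) ⊔ S.map (ρ.phi k) := by
  rintro _ ⟨η, hη, rfl⟩
  have : ρ.phi i η = ρ.phi j (-η) + ρ.phi k (-η) := by
    rw [map_neg, map_neg]
    rw [← sub_eq_zero, ← ρ.phi_add h η]; abel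
  rw [this]
  exact Submodule.add_mem_sup (Submodule.mem_map_of_mem (neg_mem hη))
    (Submodule.mem_map_of_mem (neg_mem hη))

/-- Values of the innermost map lie in Φ⁺Φ⁺ρ(yᵢ), which the next map sends into Φ⁺ρ(xᵢ) = ker φᵢ. -/
theorem phi_phi_phi (i : Fin 3) (η : ρ.coxeter.coxeter.coxeterSpace) :
    ρ.phi i (ρ.coxeter.phi i (ρ.coxeter.coxeter.phi i η)) = 0 := by
  have h : ρ.coxeter.phi i (ρ.coxeter.coxeter.phi i η) ∈ ρ.coxeter (x i) :=
    ρ.coxeter.coxeter.phi_mem i η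
  simpa [coxeter_x] using h

/-- `φᵢφⱼφᵢ = -φᵢφₖφᵢ`. -/
theorem map_phi_phi_phi {i j k : Fin 3} (h : IsTriple i j k)
    (S : Submodule K ρ.coxeter.coxeter.coxeterSpace) :
    ((S.map (ρ.coxeter.coxeter.phi i)).map (ρ.coxeter.phi j)).map (ρ.phi i) =
      ((S.map (ρ.coxeter.coxeter.phi i)).map (ρ.coxeter.phi k)).map (ρ.phi i) := by
  have hS : ∀ η ∈ S.map (ρ.coxeter.coxeter.phi i), ρ.phi i (ρ.coxeter.phi i η) = 0 := by
    rintro _ ⟨η, -, rfl⟩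
    exact ρ.phi_phi_phi i η
  generalize S.map (ρ.coxeter.coxeter.phi i) = T at hS
  have key : ∀ {i j k : Fin 3}, IsTriple i j k →
      (∀ η ∈ T, ρ.phi i (ρ.coxeter.phi i η) = 0) →
      (T.map (ρ.coxeter.phi j)).map (ρ.phi i) ≤ (T.map (ρ.coxeter.phi k)).map (ρ.phi i) := by
    intro i j k h hT
    refine map_map_le_of_add_eq_zero (K := K) (U := ρ.coxeterSpace) (V := V)
      (W := ρ.coxeter.coxeterSpace) (f := ρ.coxeter.phi j) (f' := ρ.coxeter.phi k)
      (g := ρ.phi i) (S := T) ?_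
    intro η hη
    have h1 := congrArg (ρ.phi i) (ρ.coxeter.phi_add h η)
    rwa [map_add, map_add, map_zero, hT η hη, zero_add] at h1
  exact le_antisymm (key h hS) (key h.swap hS)

/-- The image under `φᵢ` of the subspace cut out by `ηᵢ ∈ ρ(b)`, `ηⱼ ∈ ρ(c)`, `ηₖ ∈ ρ(d)`. -/
theorem map_phi_box_apply {i j k : Fin 3} (h : IsTriple i j k) (b c d : D222) :
    Submodule.map (ρ.phi i) (Submodule.comap (ρ.phi i) (ρ b) ⊓ Submodule.comap (ρ.phi j) (ρ c) ⊓
      Submodule.comap (ρ.phi k) (ρ d)) = ρ (y i ⊓ b ⊓ (y j ⊓ c ⊔ y k ⊓ d)) := by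
  simp only [ρ.map_phi_box h, apply_inf, apply_sup]

theorem map_phi_comap_comap {i j k : Fin 3} (h : IsTriple i j k) (c d : D222) :
    Submodule.map (ρ.phi i) (Submodule.comap (ρ.phi j) (ρ c) ⊓ Submodule.comap (ρ.phi k) (ρ d)) =
      ρ (y i ⊓ (y j ⊓ c ⊔ y k ⊓ d)) := by
  simpa [ρ.map_top] using ρ.map_phi_box_apply h ⊤ c d

theorem map_phi_comap {i j k : Fin 3} (h : IsTriple i j k) (c : D222) :
    Submodule.map (ρ.phi i) (Submodule.comap (ρ.phi j) (ρ c)) = ρ (y i ⊓ (y j ⊓ c ⊔ y k)) := by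
  simpa [ρ.map_top] using ρ.map_phi_comap_comap h c ⊤

/-- The image under `φᵢ` of the subspace cut out by `ηⱼ = 0`, `ηᵢ ∈ ρ(b)`, `ηₖ ∈ ρ(d)`. -/
theorem map_phi_box_bot {i j k : Fin 3} (h : IsTriple i j k) (b d : D222) :
    Submodule.map (ρ.phi i) (Submodule.comap (ρ.phi i) (ρ b) ⊓ Submodule.comap (ρ.phi j) ⊥ ⊓
      Submodule.comap (ρ.phi k) (ρ d)) = ρ (y i ⊓ b ⊓ (y k ⊓ d)) := by
  simp only [ρ.map_phi_box h, apply_inf, inf_bot_eq, bot_sup_eq]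

/-- An element above xᵢ gives a subspace containing ker φᵢ, so it is recovered from its image under
φᵢ. -/
theorem coxeter_eq_comap {i : Fin 3} {b : D222} (h : x i ≤ b) :
    ρ.coxeter b = Submodule.comap (ρ.phi i) (Submodule.map (ρ.phi i) (ρ.coxeter b)) := by
  rw [← coxeter_x_sup, ← coxeter_sup, sup_eq_right.2 h]

/-- Both elements lie above xᵢ, so only their images under φᵢ matter. The recursion on each side
does the rest, and the two claims are inductively independent. -/
theorem coxeter_a_A (n : ℕ) {i j k : Fin 3} (h : IsTriple i j k) :
    ρ.coxeter (a n i j) = Submodule.comap (ρ.phi i) (ρ (A n k j)) ∧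
      ρ.coxeter (A n i j) = Submodule.comap (ρ.phi i) (ρ (a n i k)) := by
  induction n generalizing i j k with
  | zero => simp [a_zero, A_zero, map_top]
  | succ n ih =>
    constructor
    · rw [a_succ h, coxeter_sup, coxeter_x_sup, coxeter_inf, coxeter_y, (ih h.rotate.rotate).1,
        ← Submodule.comap_inf, ← apply_inf, ρ.map_phi_comap h, comap_phi_y_inf,
        A_succ h.rotate.swap, ← inf_assoc, inf_eq_right.2 (x_le_y j), sup_comm]
    · rw [ρ.coxeter_eq_comap (x_le_A (n + 1) i j), A_succ h, coxeter_sup, Submodule.map_sup,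
        coxeter_y, coxeter_inf, coxeter_x, (ih h.rotate).2, a_succ h.swap]
      have h1 := ρ.map_phi_box_apply h (x i) ⊤ ⊤
      have h2 := ρ.map_phi_box_bot h ⊤ (a n k j)
      simp only [ρ.map_top, Submodule.comap_top, inf_top_eq, top_inf_eq] at h1 h2
      have h3 : y k ⊓ a n k j ≤ y j ⊔ y k := inf_le_left.trans le_sup_right
      -- The factors yᵢ and yⱼ + yₖ are invisible to φᵢ⁻¹; with them inserted, the target splits
      -- into the two images `h1` and `h2`.
      have h4 : y i ⊓ (x i ⊔ y k ⊓ a n k j) ⊓ (y j ⊔ y k) =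
          x i ⊓ (y j ⊔ y k) ⊔ y i ⊓ (y k ⊓ a n k j) := by
        rw [inf_comm (y i), sup_inf_assoc_of_le _ (x_le_y i), inf_comm _ (y i), sup_comm,
          sup_inf_assoc_of_le _ (inf_le_right.trans h3), sup_comm]
      rw [h1, h2, inf_eq_right.2 (x_le_y i), ← apply_sup, ← h4, ρ.comap_phi_inf_sup h,
        comap_phi_y_inf]

theorem coxeter_a (n : ℕ) {i j k : Fin 3} (h : IsTriple i j k) :
    ρ.coxeter (a n i j) = Submodule.comap (ρ.phi i) (ρ (A n k j)) := (ρ.coxeter_a_A n h).1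

theorem coxeter_A (n : ℕ) {i j k : Fin 3} (h : IsTriple i j k) :
    ρ.coxeter (A n i j) = Submodule.comap (ρ.phi i) (ρ (a n i k)) := (ρ.coxeter_a_A n h).2

end Representation
/-! ### Identities in modular lattices -/

section modular

variable {L : Type*} [Lattice L] [IsModularLattice L]

theorem inf_sup_inf_eq (p z s : L) (h : p ≤ s) : p ⊔ z ⊓ s = (p ⊔ z) ⊓ s :=
  (sup_inf_assoc_of_le z h).symm

theorem inf_sup_inf_self (b c d : L) : b ⊓ (c ⊔ b ⊓ d) = b ⊓ c ⊔ b ⊓ d := by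
  rw [sup_comm, inf_comm, sup_inf_assoc_of_le c inf_le_left, sup_comm, inf_comm c]

/-- Both sides equal bc + bd: under a meet with b, a factor b may move from one summand to the
other. -/
theorem inf_sup_inf_comm (b c d : L) : b ⊓ (c ⊔ b ⊓ d) = b ⊓ (c ⊓ b ⊔ d) := by
  rw [inf_sup_inf_self, inf_comm c, sup_comm _ d, inf_sup_inf_self, sup_comm]

/-- Since c absorbs p, r(b + p) may be replaced by p + r(b + p) = p + b(p + r); then the factor b
moves across. -/
theorem inf_sup_inf_sup {p r b c : L} (h : p ≤ c) :
    b ⊓ (c ⊔ r ⊓ (b ⊔ p)) = b ⊓ (c ⊓ b ⊔ (p ⊔ r)) := by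
  have h1 : p ⊔ r ⊓ (b ⊔ p) = p ⊔ b ⊓ (p ⊔ r) := by
    rw [inf_sup_inf_eq _ _ _ le_sup_right, inf_sup_inf_eq _ _ _ le_sup_left, inf_comm, sup_comm b]
  rw [← inf_sup_inf_comm, ← sup_eq_left.2 h, sup_assoc, h1, sup_assoc]

/-- Two exchanges of factors: first inside c, using p ≤ c, to get p(b + dc), then inside d, after
pulling b + dc out of the sum by m ≤ b. -/
theorem inf_sup_inf_sup_inf {b c d m p : L} (hm : m ≤ b) (hp : p ≤ c) :
    d ⊓ (m ⊔ p ⊓ (b ⊓ c ⊔ d)) = d ⊓ (m ⊔ p) ⊓ (b ⊓ d ⊔ c) := by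
  have key : p ⊓ (b ⊓ c ⊔ d) = p ⊓ (b ⊔ d ⊓ c) := by
    rw [← inf_eq_left.2 hp, inf_assoc, inf_assoc, ← inf_sup_inf_comm, inf_comm c d]
  rw [key, inf_sup_inf_eq _ _ _ (hm.trans le_sup_left), inf_left_comm, inf_sup_inf_comm,
    inf_left_comm, inf_assoc]

end modular

theorem y_inf_x_inf (i : Fin 3) (b : D222) : y i ⊓ (x i ⊓ b) = x i ⊓ b :=
  inf_eq_right.2 (inf_le_left.trans (x_le_y i))

theorem y_inf_x (i : Fin 3) : y i ⊓ x i = x i := inf_eq_right.2 (x_le_y i)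

/-! ### Boxes, and Φ⁺ on the factors h -/

namespace Representation

variable {K V : Type*} [Field K] [AddCommGroup V] [Module K V] (ρ : Representation K V)

/-- The subspace cut out by `ηᵢ ∈ ρ(b)`, `ηⱼ ∈ ρ(c)`, `ηₖ ∈ ρ(d)`. -/
def box (i j k : Fin 3) (b c d : D222) : Submodule K ρ.coxeterSpace :=
  Submodule.comap (ρ.phi i) (ρ b) ⊓ Submodule.comap (ρ.phi j) (ρ c) ⊓
    Submodule.comap (ρ.phi k) (ρ d)

variable {i j k : Fin 3}

theorem map_phi_fst_box (h : IsTriple i j k) (b c d : D222) :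
    Submodule.map (ρ.phi i) (ρ.box i j k b c d) = ρ (y i ⊓ b ⊓ (y j ⊓ c ⊔ y k ⊓ d)) :=
  ρ.map_phi_box_apply h b c d

theorem map_phi_thd_box (h : IsTriple i j k) (b c d : D222) :
    Submodule.map (ρ.phi k) (ρ.box i j k b c d) = ρ (y k ⊓ d ⊓ (y i ⊓ b ⊔ y j ⊓ c)) := by
  rw [← ρ.map_phi_box_apply h.rotate, box, inf_comm, inf_assoc]

theorem coxeter_x_sup_x (h : IsTriple i j k) :
    ρ.coxeter (x i ⊔ x j) = Submodule.comap (ρ.phi i) (ρ (y k)) := by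
  have := ρ.map_phi_box_bot h ⊤ ⊤
  simp only [ρ.map_top, Submodule.comap_top, inf_top_eq, top_inf_eq] at this
  rw [coxeter_sup, coxeter_x_sup, coxeter_x, this, comap_phi_y_inf]

theorem coxeter_x_sup_a_inf_A (h : IsTriple i j k) (q m : ℕ) :
    ρ.coxeter (x i ⊔ a q k j ⊓ A m k j) =
      Submodule.comap (ρ.phi i) (ρ (y j ⊔ y k ⊓ (A q i j ⊓ a m k i))) := by
  rw [coxeter_sup, coxeter_x_sup, coxeter_inf, ρ.coxeter_a q h.rotate.swap,
    ρ.coxeter_A m h.rotate.swap, ← Submodule.comap_inf, ← apply_inf, ρ.map_phi_comap h.swap,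
    comap_phi_y_inf, sup_comm]

theorem coxeter_y_inf_y_sup (h : IsTriple i j k) (q m : ℕ) :
    ρ.coxeter (y j ⊓ y k ⊔ A q i j ⊓ a (m + 1) k i) =
      Submodule.comap (ρ.phi i) (ρ (x k ⊔ a (q + 1) j i ⊓ A (m + 1) j i)) := by
  have hx : x i ≤ y j ⊓ y k ⊔ A q i j ⊓ a (m + 1) k i :=
    (le_inf (x_le_A _ _ _) (x_le_a' _ _ _)).trans le_sup_right
  have h1 := ρ.map_phi_fst_box h ⊤ (x j) (x k)
  have h2 := ρ.map_phi_fst_box h (a q i k) ⊤ (A (m + 1) j i)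
  simp only [box, ρ.map_top, Submodule.comap_top, inf_top_eq, top_inf_eq] at h1 h2
  -- The last two rewrites insert yⱼ + yₖ and yᵢ on the right, where φᵢ⁻¹ does not see them; what
  -- remains is an identity in the lattice.
  rw [ρ.coxeter_eq_comap hx, coxeter_sup, Submodule.map_sup, coxeter_inf, coxeter_inf, coxeter_y,
    coxeter_y, ρ.coxeter_A q h, ρ.coxeter_a (m + 1) h.rotate, h1, h2, ← apply_sup,
    ← ρ.comap_phi_inf_sup h (x k ⊔ _), ← comap_phi_y_inf ρ i ((x k ⊔ _) ⊓ _)]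
  congr 2
  have e1 : a (q + 1) j i ⊓ A (m + 1) j i = x j ⊔ y i ⊓ a q i k ⊓ A (m + 1) j i := by
    rw [a_succ h.swap.rotate, sup_inf_assoc_of_le _ (x_le_A _ _ _)]
  have e2 : y j ⊔ y k ⊓ A (m + 1) j i = A (m + 1) j i ⊓ (y j ⊔ y k) := by
    rw [← sup_inf_assoc_of_le _ (y_le_A (m + 1) j i), inf_comm]
  rw [e1, e2, ← sup_assoc, sup_inf_assoc_of_le _
    (sup_le ((x_le_y k).trans le_sup_right) ((x_le_y j).trans le_sup_left))]
  simp only [inf_assoc]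
  rw [inf_sup_inf_self, y_inf_x, y_inf_x, sup_comm (x j)]

end Representation

/-! ### Families of rows and their box descriptions -/

/-- `s'` collects the values of `φᵢ` on the polynomials `s`, evaluated in `Φ⁺ρ`. -/
def IsSucc (K : Type*) [Field K] (i : Fin 3) (s s' : Fin 3 → D222) : Prop :=
  ∀ (V : Type v) [AddCommGroup V] [Module K V] (ρ : Representation K V) (c : Fin 3),
    (ρ.coxeter (s c)).map (ρ.phi i) = ρ (s' c)

/-- The elements `f_α`, `e_α`, `g_{α0} = e_α h`. -/
def values (f e h : D222) : Fin 3 → D222 := ![f, e, e ⊓ h]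

theorem isSucc_values {K : Type*} [Field K] {i : Fin 3} {f e h f' e' h' : D222}
    (H : ∀ (V : Type v) [AddCommGroup V] [Module K V] (ρ : Representation K V),
      (ρ.coxeter f).map (ρ.phi i) = ρ f' ∧ (ρ.coxeter e).map (ρ.phi i) = ρ e' ∧
        (ρ.coxeter (e ⊓ h)).map (ρ.phi i) = ρ (e' ⊓ h')) :
    IsSucc.{v} K i (values f e h) (values f' e' h') := by
  intro V _ _ ρ c
  obtain ⟨h1, h2, h3⟩ := H V ρ
  fin_cases c
  exacts [h1, h2, h3]

/-- The common form of the values at `γ`, `13γ` and `3(213)γ` (with `k + 1` in place of `k`), up to a cyclic shift of the indices. -/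
def gammaA (u v w : Fin 3) (k q : ℕ) : Fin 3 → D222 :=
  values (y u ⊓ y v ⊓ a q u w ⊓ A k w v)
    (y v ⊓ A k w v ⊓ a q v u ⊓ A (k + 1) u w ⊓ a q u w)
    (x u ⊔ a q w v ⊓ A (k + 1) w v)

/-- The common form of the values at `3γ`, `(213)γ` and `13(213)γ` (with `k + 1` in place of `k`), up to a cyclic shift of the indices. -/
def gammaB (u v w : Fin 3) (k q : ℕ) : Fin 3 → D222 :=
  values (y w ⊓ (x u ⊔ x v) ⊓ A q v w ⊓ a k w u)
    (y w ⊓ a k w u ⊓ A (q + 1) u v ⊓ a (k + 1) u v ⊓ A q v w)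
    (y v ⊓ y w ⊔ A q u v ⊓ a (k + 1) w u)

/-- The common form of the values at `β`, `13β` and `3(213)β`, up to a cyclic shift of the indices. -/
def betaA (u v w : Fin 3) (k q : ℕ) : Fin 3 → D222 :=
  values (y v ⊓ y w ⊓ a q v u ⊓ A k u w)
    (y v ⊓ A k w v ⊓ a q v u ⊓ A k u w ⊓ a (q + 1) u w)
    (x v ⊔ a q u w ⊓ A (k + 1) u w)

/-- The common form of the values at `3β`, `(213)β` and `13(213)β`, up to a cyclic shift of the indices. -/
def betaB (u v w : Fin 3) (k q : ℕ) : Fin 3 → D222 :=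
  values (x w ⊓ A (q + 1) u v ⊓ a k u v)
    (y w ⊓ a k w u ⊓ A (q + 1) u v ⊓ a k u v ⊓ A (q + 1) v w)
    (y u ⊓ y w ⊔ A q v w ⊓ a (k + 1) u v)

section

variable {K : Type*} [Field K] {V : Type v} [AddCommGroup V] [Module K V] (ρ : Representation K V)
  {u v w : Fin 3}

namespace Representation

/-- Each factor restricts only the coordinate of its first upper index, so the product is a box. In
this and the following lemmas the factor h, when present, refines one coordinate. -/
theorem coxeter_gammaA_e (h : IsTriple u v w) (k q : ℕ) :
    ρ.coxeter (y v ⊓ A k w v ⊓ a q v u ⊓ A (k + 1) u w ⊓ a q u w) =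
      ρ.box u v w (a (k + 1) u v ⊓ A q v w) (x v ⊓ A q w u) (a k w u) := by
  simp only [box, coxeter_y, apply_inf, Submodule.comap_inf,
    ρ.coxeter_A k h.rotate.swap, ρ.coxeter_a q h.swap.rotate, ρ.coxeter_A (k + 1) h.swap,
    ρ.coxeter_a q h.swap]
  ac_rfl

theorem coxeter_gammaA_g (h : IsTriple u v w) (k q : ℕ) :
    ρ.coxeter (y v ⊓ A k w v ⊓ a q v u ⊓ A (k + 1) u w ⊓ a q u w ⊓
        (x u ⊔ a q w v ⊓ A (k + 1) w v)) =
      ρ.box u v w (a (k + 1) u v ⊓ A q v w ⊓ (y v ⊔ y w ⊓ (A q u v ⊓ a (k + 1) w u)))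
        (x v ⊓ A q w u) (a k w u) := by
  rw [coxeter_inf, ρ.coxeter_gammaA_e h, ρ.coxeter_x_sup_a_inf_A h]
  simp only [box, apply_inf _ _ (_ ⊔ _), Submodule.comap_inf]
  ac_rfl

theorem coxeter_gammaA_f (h : IsTriple u v w) (k q : ℕ) :
    ρ.coxeter (y u ⊓ y v ⊓ a q u w ⊓ A k w v) =
      ρ.box u v w (x u ⊓ A q v w) (x v) (a k w u) := by
  simp only [box, coxeter_y, apply_inf, Submodule.comap_inf,
    ρ.coxeter_A k h.rotate.swap, ρ.coxeter_a q h.swap]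
  ac_rfl

theorem coxeter_gammaB_f (h : IsTriple u v w) (k q : ℕ) :
    ρ.coxeter (y w ⊓ (x u ⊔ x v) ⊓ A q v w ⊓ a k w u) =
      ρ.box u v w (y w) (a q v u) (x w ⊓ A k v u) := by
  simp only [box, coxeter_y, apply_inf, Submodule.comap_inf, ρ.coxeter_x_sup_x h,
    ρ.coxeter_A q h.rotate.rotate, ρ.coxeter_a k h.rotate]
  ac_rfl

theorem coxeter_gammaB_e (h : IsTriple u v w) (k q : ℕ) :
    ρ.coxeter (y w ⊓ a k w u ⊓ A (q + 1) u v ⊓ a (k + 1) u v ⊓ A q v w) =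
      ρ.box u v w (a (q + 1) u w ⊓ A (k + 1) w v) (a q v u) (x w ⊓ A k v u) := by
  simp only [box, coxeter_y, apply_inf, Submodule.comap_inf,
    ρ.coxeter_a k h.rotate, ρ.coxeter_A (q + 1) h, ρ.coxeter_a (k + 1) h,
    ρ.coxeter_A q h.rotate.rotate]
  ac_rfl

theorem coxeter_gammaB_g (h : IsTriple u v w) (k q : ℕ) :
    ρ.coxeter (y w ⊓ a k w u ⊓ A (q + 1) u v ⊓ a (k + 1) u v ⊓ A q v w ⊓
        (y v ⊓ y w ⊔ A q u v ⊓ a (k + 1) w u)) =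
      ρ.box u v w (a (q + 1) u w ⊓ A (k + 1) w v ⊓ (x w ⊔ a (q + 1) v u ⊓ A (k + 1) v u))
        (a q v u) (x w ⊓ A k v u) := by
  rw [coxeter_inf, ρ.coxeter_gammaB_e h, ρ.coxeter_y_inf_y_sup h]
  simp only [box, apply_inf _ _ (_ ⊔ _), Submodule.comap_inf]
  ac_rfl

theorem coxeter_betaA_f (h : IsTriple u v w) (k q : ℕ) :
    ρ.coxeter (y v ⊓ y w ⊓ a q v u ⊓ A k u w) =
      ρ.box u v w (a k u v) (x v ⊓ A q w u) (x w) := by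
  simp only [box, coxeter_y, apply_inf, Submodule.comap_inf,
    ρ.coxeter_A k h.swap, ρ.coxeter_a q h.swap.rotate]
  ac_rfl

theorem coxeter_betaA_e (h : IsTriple u v w) (k q : ℕ) :
    ρ.coxeter (y v ⊓ A k w v ⊓ a q v u ⊓ A k u w ⊓ a (q + 1) u w) =
      ρ.box u v w (a k u v ⊓ A (q + 1) v w) (x v ⊓ A q w u) (a k w u) := by
  simp only [box, coxeter_y, apply_inf, Submodule.comap_inf,
    ρ.coxeter_A k h.rotate.swap, ρ.coxeter_A k h.swap, ρ.coxeter_a q h.swap.rotate,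
    ρ.coxeter_a (q + 1) h.swap]
  ac_rfl

theorem coxeter_betaA_g (h : IsTriple u v w) (k q : ℕ) :
    ρ.coxeter (y v ⊓ A k w v ⊓ a q v u ⊓ A k u w ⊓ a (q + 1) u w ⊓
        (x v ⊔ a q u w ⊓ A (k + 1) u w)) =
      ρ.box u v w (a k u v ⊓ A (q + 1) v w)
        (x v ⊓ A q w u ⊓ (y w ⊔ y u ⊓ (A q v w ⊓ a (k + 1) u v))) (a k w u) := by
  rw [coxeter_inf, ρ.coxeter_betaA_e h, ρ.coxeter_x_sup_a_inf_A h.rotate.rotate]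
  simp only [box, apply_inf _ _ (_ ⊔ _), Submodule.comap_inf]
  ac_rfl

theorem coxeter_betaB_e (h : IsTriple u v w) (k q : ℕ) :
    ρ.coxeter (y w ⊓ a k w u ⊓ A (q + 1) u v ⊓ a k u v ⊓ A (q + 1) v w) =
      ρ.box u v w (a (q + 1) u w ⊓ A k w v) (a (q + 1) v u) (x w ⊓ A k v u) := by
  simp only [box, coxeter_y, apply_inf, Submodule.comap_inf,
    ρ.coxeter_a k h.rotate, ρ.coxeter_A (q + 1) h, ρ.coxeter_a k h,
    ρ.coxeter_A (q + 1) h.rotate.rotate]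
  ac_rfl

theorem coxeter_betaB_g (h : IsTriple u v w) (k q : ℕ) :
    ρ.coxeter (y w ⊓ a k w u ⊓ A (q + 1) u v ⊓ a k u v ⊓ A (q + 1) v w ⊓
        (y u ⊓ y w ⊔ A q v w ⊓ a (k + 1) u v)) =
      ρ.box u v w (a (q + 1) u w ⊓ A k w v)
        (a (q + 1) v u ⊓ (x u ⊔ a (q + 1) w v ⊓ A (k + 1) w v)) (x w ⊓ A k v u) := by
  rw [coxeter_inf, ρ.coxeter_betaB_e h, inf_comm (y u),
    ρ.coxeter_y_inf_y_sup h.rotate.rotate]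
  simp only [box, apply_inf _ _ (_ ⊔ _), Submodule.comap_inf]
  ac_rfl

end Representation

end
-- The six transitions computed directly
section

variable (K : Type*) [Field K] {u v w : Fin 3}

/-- The pattern for all six: write Φ⁺ of the row as a box, take its image, and recombine the sum of
the two other coordinates by `key`. The entry g needs a further modular identity when h does not sit
in the coordinate being read off. -/
theorem gammaA_gammaB (h : IsTriple u v w) (k q : ℕ) :
    IsSucc.{v} K w (gammaA u v w k q) (gammaB u v w k q) := by
  have key : y u ⊓ (a (k + 1) u v ⊓ A q v w) ⊔ x v ⊓ A q w u =
      A (q + 1) u v ⊓ (a (k + 1) u v ⊓ A q v w) := by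
    rw [sup_comm, x_inf_A_sup_y_inf h q (le_inf (x_le_a' _ _ _) (x_le_A _ _ _))]
  refine isSucc_values fun V _ _ ρ => ⟨?_, ?_, ?_⟩
  · rw [ρ.coxeter_gammaA_f h, ρ.map_phi_thd_box h, y_inf_x, y_inf_x_inf, sup_comm, sup_comm (x u),
      inf_comm (x u), inf_comm (A q v w), inf_sup_inf_eq _ _ _ (x_le_A q v w)]
    congr 1; ac_rfl
  · rw [ρ.coxeter_gammaA_e h, ρ.map_phi_thd_box h, y_inf_x_inf, key]
    congr 1; ac_rfl
  · rw [ρ.coxeter_gammaA_g h, ρ.map_phi_thd_box h, y_inf_x_inf, ← inf_assoc (y u), sup_comm,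
      inf_sup_inf_eq _ _ _ (inf_le_left.trans ((x_le_y v).trans le_sup_left)), sup_comm, key]
    -- Here y_w moves from the second summand onto y_v, which gives the summand y_vy_w of the new h.
    have e := inf_sup_inf_comm (y w) (y v) (A q u v ⊓ a (k + 1) w u)
    have e' (b c d : D222) : y w ⊓ b ⊓ (c ⊓ d) = b ⊓ c ⊓ (y w ⊓ d) := by ac_rfl
    rw [e', e]
    congr 1; ac_rfl

theorem gammaA_betaB (h : IsTriple u v w) (k q : ℕ) :
    IsSucc.{v} K u (gammaA u v w k (q + 1)) (betaB v w u (k + 1) q) := by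
  have key : x v ⊓ A (q + 1) w u ⊔ y w ⊓ a k w u = A (q + 1) w u ⊓ a (k + 1) v w :=
    x_inf_sup_y_inf_a h.rotate.rotate k (y_le_A _ _ _)
  refine isSucc_values fun V _ _ ρ => ⟨?_, ?_, ?_⟩
  · rw [ρ.coxeter_gammaA_f h, ρ.map_phi_fst_box h, y_inf_x, y_inf_x_inf,
      ← a_succ h.rotate.rotate]
  · rw [ρ.coxeter_gammaA_e h, ρ.map_phi_fst_box h, y_inf_x_inf, key]
    congr 1; ac_rfl
  · rw [ρ.coxeter_gammaA_g h, ρ.map_phi_fst_box h, y_inf_x_inf, key]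
    -- This p is the second summand of A_{q+1}^{uv} = y_u + x_vA_q^{wu}, so b + p becomes that
    -- atomic element; this is where the successor q + 1 is used.
    have e := inf_sup_inf_sup (p := x v ⊓ A q w u) (r := y w ⊓ a (k + 1) w u) (b := y u)
      (c := y v) (inf_le_left.trans (x_le_y v))
    have e1 := x_inf_sup_y_inf_a h.rotate.rotate (k + 1) (b := A q w u) (y_le_A _ _ _)
    rw [e1, ← A_succ h, inf_assoc (y w), inf_comm (a (k + 1) w u)] at e
    have e' (b c d : D222) : y u ⊓ (b ⊓ c) ⊓ d = b ⊓ d ⊓ (y u ⊓ c) := by ac_rfl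
    rw [e', e]
    congr 1; ac_rfl

theorem gammaB_gammaA (h : IsTriple u v w) (k q : ℕ) :
    IsSucc.{v} K u (gammaB u v w k q) (gammaA w u v k (q + 1)) := by
  have key : y v ⊓ a q v u ⊔ x w ⊓ A k v u = A k v u ⊓ a (q + 1) w v := by
    rw [sup_comm, x_inf_sup_y_inf_a h.rotate.swap q (y_le_A _ _ _)]
  refine isSucc_values fun V _ _ ρ => ⟨?_, ?_, ?_⟩
  · rw [ρ.coxeter_gammaB_f h, ρ.map_phi_fst_box h, y_inf_x_inf, key]
    congr 1; ac_rfl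
  · rw [ρ.coxeter_gammaB_e h, ρ.map_phi_fst_box h, y_inf_x_inf, key]
    congr 1; ac_rfl
  · rw [ρ.coxeter_gammaB_g h, ρ.map_phi_fst_box h, y_inf_x_inf, key]
    congr 1; ac_rfl

theorem betaA_betaB (h : IsTriple u v w) (k q : ℕ) :
    IsSucc.{v} K w (betaA u v w k q) (betaB u v w k q) := by
  have key (b : D222) (hb : x v ≤ b) : y u ⊓ b ⊔ x v ⊓ A q w u = A (q + 1) u v ⊓ b := by
    rw [sup_comm, x_inf_A_sup_y_inf h q hb]
  refine isSucc_values fun V _ _ ρ => ⟨?_, ?_, ?_⟩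
  · rw [ρ.coxeter_betaA_f h, ρ.map_phi_thd_box h, y_inf_x_inf, key _ (x_le_a' _ _ _), y_inf_x]
    congr 1; ac_rfl
  · rw [ρ.coxeter_betaA_e h, ρ.map_phi_thd_box h, y_inf_x_inf,
      key _ (le_inf (x_le_a' _ _ _) (x_le_A _ _ _))]
    congr 1; ac_rfl
  · rw [ρ.coxeter_betaA_g h, ρ.map_phi_thd_box h, inf_assoc (x v), y_inf_x_inf, ← inf_assoc (x v)]
    -- Here h refines the coordinate v, one of the two summed. The identity frees it, and bd + c
    -- becomes the new h.
    have e := inf_sup_inf_sup_inf (b := y u) (c := A q v w ⊓ a (k + 1) u v) (d := y w)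
      (m := y u ⊓ (a k u v ⊓ A (q + 1) v w)) (p := x v ⊓ A q w u) inf_le_left
      (inf_le_left.trans (le_inf (x_le_A _ _ _) (x_le_a' _ _ _)))
    rw [key _ (le_inf (x_le_a' _ _ _) (x_le_A _ _ _))] at e
    rw [inf_right_comm, sup_comm (y w), e]
    congr 1; ac_rfl

theorem betaA_gammaB (h : IsTriple u v w) (k q : ℕ) :
    IsSucc.{v} K u (betaA u v w k q) (gammaB v w u k q) := by
  have key : x v ⊓ A q w u ⊔ y w ⊓ a k w u = A q w u ⊓ a (k + 1) v w :=
    x_inf_sup_y_inf_a h.rotate.rotate k (y_le_A _ _ _)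
  refine isSucc_values fun V _ _ ρ => ⟨?_, ?_, ?_⟩
  · rw [ρ.coxeter_betaA_f h, ρ.map_phi_fst_box h, y_inf_x_inf, y_inf_x, sup_comm,
      inf_sup_inf_eq _ _ _ (x_le_A _ _ _), sup_comm]
    congr 1; ac_rfl
  · rw [ρ.coxeter_betaA_e h, ρ.map_phi_fst_box h, y_inf_x_inf, key]
    congr 1; ac_rfl
  · rw [ρ.coxeter_betaA_g h, ρ.map_phi_fst_box h, inf_assoc (x v), y_inf_x_inf, ← inf_assoc (x v),
      sup_comm, inf_sup_inf_eq _ _ _ (inf_le_left.trans le_sup_left), sup_comm, key]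
    have e := inf_sup_inf_comm (y u) (y w) (A q v w ⊓ a (k + 1) u v)
    have e' (b c d : D222) : y u ⊓ b ⊓ (c ⊓ d) = b ⊓ c ⊓ (y u ⊓ d) := by ac_rfl
    rw [e', e]
    congr 1; ac_rfl

theorem betaB_betaA (h : IsTriple u v w) (k q : ℕ) :
    IsSucc.{v} K u (betaB u v w k q) (betaA w u v k (q + 1)) := by
  have key : y v ⊓ a (q + 1) v u ⊔ x w ⊓ A k v u = A k v u ⊓ a (q + 2) w v := by
    rw [sup_comm, x_inf_sup_y_inf_a h.rotate.swap (q + 1) (y_le_A _ _ _)]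
  refine isSucc_values fun V _ _ ρ => ⟨?_, ?_, ?_⟩
  -- The factor x_w imposes η_w = 0, the zero subspace rather than some ρ(b), so the image formula
  -- with ⊥ is required.
  · have e := ρ.map_phi_box_bot h.swap (a (q + 1) u w ⊓ A k w v) ⊤
    rw [ρ.map_top, Submodule.comap_top, inf_top_eq, inf_top_eq] at e
    simp only [ρ.coxeter_inf, ρ.coxeter_x, ρ.coxeter_A (q + 1) h, ρ.coxeter_a k h]
    rw [Representation.apply_inf ρ (a _ _ _), Submodule.comap_inf] at e
    rw [inf_assoc, inf_comm, e]
    congr 1; ac_rfl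
  · rw [ρ.coxeter_betaB_e h, ρ.map_phi_fst_box h, y_inf_x_inf, key]
    congr 1; ac_rfl
  · rw [ρ.coxeter_betaB_g h, ρ.map_phi_fst_box h, y_inf_x_inf, ← inf_assoc (y v), sup_comm,
      inf_sup_inf_eq _ _ _, sup_comm, key]
    · congr 1; ac_rfl
    · exact inf_le_left.trans ((le_inf (x_le_a _ _ _) (x_le_A _ _ _)).trans le_sup_right)

end
-- Transitions deduced from φᵢφⱼφᵢ = -φᵢφₖφᵢ
section

variable {K : Type*} [Field K]

/-- Since `φᵢφⱼφᵢ = -φᵢφₖφᵢ`, the values along `iji` and `iki` agree. -/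
theorem IsSucc.apply_eq {i j k : Fin 3} (h : IsTriple i j k) {s s₀ s₁ s₂ t₀ t₁ t₂ : Fin 3 → D222}
    (H₀ : IsSucc.{v} K i s s₀) (H₁ : IsSucc.{v} K j s₀ s₁) (H₂ : IsSucc.{v} K i s₁ s₂)
    (G₁ : IsSucc.{v} K k t₀ t₁) (G₂ : IsSucc.{v} K i t₁ t₂)
    (E : ∀ (V : Type v) [AddCommGroup V] [Module K V] (ρ : Representation K V) (c : Fin 3),
      ρ (s₀ c) = ρ (t₀ c))
    (V : Type v) [AddCommGroup V] [Module K V] (ρ : Representation K V) (c : Fin 3) :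
    ρ (s₂ c) = ρ (t₂ c) := by
  rw [← H₂ V ρ, ← H₁ _ ρ.coxeter, ← G₂ V ρ, ← G₁ _ ρ.coxeter, ← E _ ρ.coxeter.coxeter,
    ← H₀ _ ρ.coxeter.coxeter]
  exact ρ.map_phi_phi_phi h _

/-- The paths iji and iki from s have the same value, so the last step of the first path follows
from the other steps. A common predecessor s along i is essential. `IsSucc` ranges over all
representations so that it also applies to Φ⁺ρ and Φ⁺Φ⁺ρ. -/
theorem IsSucc.replace {i j k : Fin 3} (h : IsTriple i j k) {s s₀ s₁ t₁ t₂ : Fin 3 → D222}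
    (H₀ : IsSucc.{v} K i s s₀) (H₁ : IsSucc.{v} K j s₀ s₁) (G₁ : IsSucc.{v} K k s₀ t₁)
    (G₂ : IsSucc.{v} K i t₁ t₂) : IsSucc.{v} K i s₁ t₂ := by
  intro V _ _ ρ c
  rw [← H₁ _ ρ.coxeter, ← G₂ V ρ, ← G₁ _ ρ.coxeter, ← H₀ _ ρ.coxeter.coxeter]
  exact ρ.map_phi_phi_phi h _

end

/-- The values at `1(21)^{2k}`. -/
def oddA (u v w : Fin 3) (k : ℕ) : Fin 3 → D222 :=
  values (x u ⊓ A k v w ⊓ a k v w)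
    (y u ⊓ A k w u ⊓ a k u v ⊓ A k v w ⊓ a k v w)
    (y v ⊓ a k v u ⊔ y w ⊓ a k w u)

/-- The values at `1(21)^{2k+1}`. -/
def oddB (u v w : Fin 3) (k : ℕ) : Fin 3 → D222 :=
  values (y u ⊓ (x v ⊔ x w) ⊓ A k w u ⊓ a k u v)
    (y u ⊓ A k w u ⊓ a k u v ⊓ A (k + 1) v w ⊓ a (k + 1) v w)
    (y u ⊓ a (k + 1) u v ⊔ y u ⊓ a (k + 1) u w)

/-! ### The odd rows and the remaining transitions -/

section

variable {u v w : Fin 3}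

/-- Since h enters only through g = e h, it matters only below e. -/
theorem values_congr {f e g f' e' g' : D222} (hf : f = f') (he : e = e') (hg : e ⊓ g = e ⊓ g') :
    values f e g = values f' e' g' := by
  subst hf he; simp [values, hg]

/-- Only the factors h differ, and they agree below e. For either inclusion e is bounded by suitable
atomic expressions and the modular law is applied; the leftover terms are controlled by
`y_inf_y_inf_a_le_A` and `y_inf_y_inf_a_inf_A_le_a` respectively. -/
theorem oddA_succ (h : IsTriple u v w) (k : ℕ) :
    oddA u v w (k + 1) = betaB v w u (k + 1) k := by
  have hR : A k w u ⊓ a (k + 2) v w = x v ⊓ A k w u ⊔ y w ⊓ a (k + 1) w u :=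
    (x_inf_sup_y_inf_a h.rotate.rotate (k + 1) (y_le_A k w u)).symm
  refine values_congr rfl (by ac_rfl) (le_antisymm (le_inf inf_le_left ?_) (le_inf inf_le_left ?_))
  · have h1 : y v ⊓ a (k + 1) v u = x v ⊔ y u ⊓ y v ⊓ a k u w := by
      rw [a_succ h.swap.rotate, inf_comm (y v), sup_inf_assoc_of_le _ (x_le_y v), inf_right_comm]
    have h2 : y u ⊓ y v ⊓ a k u w ⊔ y w ⊓ a (k + 1) w u ≤ A k w u :=
      sup_le (y_inf_y_inf_a_le_A h k) (inf_le_left.trans (y_le_A k w u))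
    have h3 : y u ⊓ A (k + 1) w u ⊓ a (k + 1) u v ⊓ A (k + 1) v w ⊓ a (k + 1) v w ≤ A k w u :=
      inf_le_left.trans (inf_le_left.trans (inf_le_left.trans
        (inf_le_right.trans (A_succ_le k w u))))
    refine (inf_le_inf_right _ h3).trans ?_
    rw [h1, sup_assoc, inf_comm, sup_comm (x v), sup_inf_assoc_of_le _ h2, hR, inf_comm (y v)]
    exact sup_le (sup_le (inf_le_left.trans le_sup_left) (le_sup_right.trans le_sup_right))
      (le_sup_left.trans le_sup_right)
  · have h1 : y u ⊓ A (k + 1) w u ⊓ a (k + 1) u v ⊓ A (k + 1) v w ⊓ a (k + 1) v w ≤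
        x v ⊓ A k w u ⊔ y w ⊓ a k w u := by
      rw [x_inf_sup_y_inf_a h.rotate.rotate k (y_le_A k w u)]
      exact inf_le_inf_right _ (inf_le_left.trans (inf_le_left.trans
        (inf_le_right.trans (A_succ_le k w u))))
    have h2 : y v ⊓ y u ⊓ (x v ⊓ A k w u ⊔ y w ⊓ a k w u) ≤ y v ⊓ a (k + 1) v u := by
      refine le_inf (inf_le_left.trans inf_le_left) ?_
      have h3 : y v ⊓ y u ⊓ (x v ⊓ A k w u ⊔ y w ⊓ a k w u) ≤
          (x v ⊓ A k w u ⊔ y v ⊓ y w ⊓ a k w u) ⊓ A (k + 1) u v := by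
        refine le_inf ?_ (inf_le_left.trans (inf_le_right.trans (y_le_A _ _ _)))
        rw [inf_assoc (y v) (y w), inf_comm (y v) (y w ⊓ _),
          ← sup_inf_assoc_of_le _ (inf_le_left.trans (x_le_y v)), inf_comm]
        exact inf_le_inf_left _ inf_le_left
      have h4 : x v ⊓ A k w u ≤ A (k + 1) u v := (A_succ h k).symm ▸ le_sup_right
      refine h3.trans ?_
      rw [sup_inf_assoc_of_le _ h4]
      exact sup_le (inf_le_left.trans (x_le_a _ _ _)) (y_inf_y_inf_a_inf_A_le_a h k)
    have h3 : x v ⊓ A k w u ⊔ y w ⊓ a (k + 1) w u ≤ x v ⊓ A k w u ⊔ y w ⊓ a k w u :=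
      sup_le_sup_left (inf_le_inf_left _ (a_succ_le k w u)) _
    rw [hR]
    refine (inf_le_inf_right _ h1).trans ?_
    rw [inf_comm, sup_comm, sup_inf_assoc_of_le _ h3]
    exact sup_le (sup_le_sup_right (inf_le_left.trans (le_inf (x_le_y v) (x_le_a _ _ _))) _)
      (h2.trans le_sup_left)

theorem oddB_eq (h : IsTriple u v w) (k : ℕ) : oddB u v w k = gammaB v w u k k := by
  refine values_congr (by ac_rfl) (by ac_rfl)
    (le_antisymm (le_inf inf_le_left ?_) (le_inf inf_le_left ?_))
  · have h1 : y u ⊓ a (k + 1) u w = x u ⊔ y w ⊓ y u ⊓ a k w v := by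
      rw [a_succ h.swap, inf_comm (y u), sup_inf_assoc_of_le _ (x_le_y u), inf_right_comm]
    have h2 : y u ⊓ A k w u ⊓ a k u v ⊓ A (k + 1) v w ⊓ a (k + 1) v w ≤ A k v w :=
      inf_le_left.trans (inf_le_right.trans (A_succ_le k v w))
    refine (inf_le_inf_right _ h2).trans ?_
    rw [h1, ← sup_assoc, sup_eq_left.2 (le_inf (x_le_y u) (x_le_a (k + 1) u v)), inf_comm,
      sup_comm, sup_inf_assoc_of_le _ (y_inf_y_inf_a_le_A h.rotate k)]
    exact sup_le (inf_le_left.trans le_sup_left)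
      ((le_inf inf_le_right (inf_le_left.trans inf_le_right)).trans le_sup_right)
  · have h1 : y u ⊓ A k w u ⊓ a k u v ⊓ A (k + 1) v w ⊓ a (k + 1) v w ≤
        y u ⊓ a k u v ⊓ A k v w :=
      inf_le_left.trans (inf_le_inf (inf_le_inf_right _ inf_le_left) (A_succ_le k v w))
    have h2 : y w ⊓ y u ⊓ (y u ⊓ a k u v ⊓ A k v w) ≤ y u ⊓ a (k + 1) u w := by
      refine le_inf (inf_le_left.trans inf_le_right) ?_
      refine le_trans (le_inf (inf_le_left.trans inf_le_left) ?_) (y_inf_a_le h.swap k)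
      cases k with
      | zero => exact le_top
      | succ k =>
        refine le_trans ?_ (y_inf_y_inf_a_inf_A_le_a h.rotate.rotate k)
        exact le_inf (le_inf inf_le_left (inf_le_right.trans (inf_le_left.trans
          (inf_le_right.trans (a_succ_le k u v))))) (inf_le_right.trans inf_le_right)
    have h3 : y u ⊓ (A k v w ⊓ a (k + 1) u v) ≤ y u ⊓ a k u v ⊓ A k v w :=
      le_inf (inf_le_inf_left _ (inf_le_right.trans (a_succ_le k u v)))
        (inf_le_right.trans inf_le_left)
    refine (inf_le_inf_right _ h1).trans ?_
    have h4 : y u ⊓ a k u v ⊓ A k v w ⊓ (y w ⊓ y u ⊔ A k v w ⊓ a (k + 1) u v) ≤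
        (y u ⊓ (A k v w ⊓ a (k + 1) u v) ⊔ y w ⊓ y u) ⊓ (y u ⊓ a k u v ⊓ A k v w) := by
      refine le_inf ?_ inf_le_left
      rw [sup_comm _ (y w ⊓ y u), inf_comm (y u) (A k v w ⊓ a (k + 1) u v),
        ← sup_inf_assoc_of_le _ inf_le_right]
      exact le_inf inf_le_right (inf_le_left.trans (inf_le_left.trans inf_le_left))
    refine h4.trans ?_
    rw [sup_inf_assoc_of_le _ h3]
    exact sup_le_sup (inf_le_inf_left _ inf_le_right) h2

variable (K : Type*) [Field K]

/-- The one-term sequence is not covered by `oddA_succ`, so its transition is computed by hand. -/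
theorem oddA_zero_betaA (h : IsTriple u v w) :
    IsSucc.{v} K v (oddA u v w 0) (betaA u v w 0 0) := by
  refine isSucc_values fun V _ _ ρ => ⟨?_, ?_, ?_⟩
  · have e := ρ.map_phi_box_bot h.swap.rotate ⊤ ⊤
    simp only [ρ.map_top, Submodule.comap_top, inf_top_eq, top_inf_eq] at e
    simp only [a_zero, A_zero, inf_top_eq]
    rw [ρ.coxeter_x, e]
  · simp only [a_zero, A_zero, inf_top_eq, a_succ h.swap]
    rw [ρ.coxeter_y, ρ.map_phi_comap h.swap.rotate, y_inf_x]
  · simp only [a_zero, A_zero, inf_top_eq, top_inf_eq, a_succ h.swap, A_succ h.swap]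
    -- y_v + y_w lies above x_v, so it is the preimage of its image under φ_v.
    have hv : ρ.coxeter (y v ⊔ y w) =
        Submodule.comap (ρ.phi v) (ρ (x v ⊔ (y u ⊔ x w))) := by
      have h1 := ρ.map_phi_fst_box h.swap.rotate (x v) ⊤ ⊤
      simp only [Representation.box, ρ.map_top, Submodule.comap_top, inf_top_eq] at h1
      rw [ρ.coxeter_eq_comap ((x_le_y v).trans le_sup_left), ρ.coxeter_sup, Submodule.map_sup,
        ρ.coxeter_y, ρ.coxeter_y, h1, ρ.map_phi_comap h.rotate.rotate, y_inf_x, y_inf_x,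
        ← ρ.apply_sup, ← ρ.comap_phi_inf_sup h.swap.rotate (x v ⊔ _),
        ← ρ.comap_phi_y_inf v (_ ⊓ _)]
      congr 2
      have h2 : (y u ⊔ x w) ⊓ y v ≤ y u ⊔ y w :=
        inf_le_left.trans (sup_le_sup_left (x_le_y w) _)
      rw [← inf_assoc, inf_comm (y v) (x v ⊔ _), sup_inf_assoc_of_le _ (x_le_y v), sup_comm (x v),
        sup_inf_assoc_of_le _ h2, sup_comm, inf_comm _ (y v), sup_comm (x w)]
    have h1 := ρ.map_phi_fst_box h.swap.rotate (x v ⊔ (y u ⊔ x w)) (x u) ⊤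
    simp only [Representation.box, ρ.map_top, Submodule.comap_top, inf_top_eq, y_inf_x] at h1
    rw [ρ.coxeter_inf, hv, ρ.coxeter_y, inf_comm, h1, inf_right_comm]

theorem oddB_zero_swap (h : IsTriple u v w) : oddB u v w 0 = oddB u w v 0 := by
  simp only [oddB, a_zero, A_zero, inf_top_eq, zero_add, a_succ h, a_succ h.swap,
    a_succ h.rotate.rotate, a_succ h.rotate.swap, A_succ h.rotate.rotate, A_succ h.rotate.swap]
  rw [sup_comm (x v) (x w), sup_comm (x v) (y w), sup_comm (y v) (x w), inf_assoc (y u),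
    inf_comm (x w ⊔ y v), ← inf_assoc, sup_comm (_ ⊓ _)]

theorem oddA_zero_swap (u v w : Fin 3) : oddA u v w 0 = oddA u w v 0 := by
  refine values_congr rfl rfl ?_
  rw [sup_comm]

theorem oddA_betaA (h : IsTriple u v w) (k : ℕ) :
    IsSucc.{v} K v (oddA u v w k) (betaA u v w k k) := by
  cases k with
  | zero => exact oddA_zero_betaA K h
  | succ k => rw [oddA_succ h]; exact betaB_betaA K h.rotate.rotate (k + 1) k

theorem betaA_oddB (h : IsTriple u v w) (k : ℕ) :
    IsSucc.{v} K u (betaA u v w k k) (oddB u v w k) := by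
  rw [oddB_eq h]; exact betaA_gammaB K h k k

theorem oddB_gammaA (h : IsTriple u v w) (k : ℕ) :
    IsSucc.{v} K v (oddB u v w k) (gammaA u v w k (k + 1)) := by
  rw [oddB_eq h]; exact gammaB_gammaA K h.rotate.rotate k k

theorem gammaA_oddA (h : IsTriple u v w) (k : ℕ) :
    IsSucc.{v} K u (gammaA u v w k (k + 1)) (oddA u v w (k + 1)) := by
  rw [oddA_succ h]; exact gammaA_betaB K h k k

/-- The common predecessor along v is `gammaB v w u k q`; the other path continues through `betaB v
w u (k + 1) q`. -/
theorem gammaB_betaA (h : IsTriple u v w) (k q : ℕ) :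
    IsSucc.{v} K v (gammaB u v w k (q + 1)) (betaA u v w (k + 1) (q + 1)) :=
  IsSucc.replace h.swap.rotate.swap (gammaB_gammaA K h.rotate.rotate k q)
    (gammaA_gammaB K h k (q + 1)) (gammaA_betaB K h k q)
    (betaB_betaA K h.rotate.rotate (k + 1) q)

theorem betaB_gammaA (h : IsTriple u v w) (k q : ℕ) (hk : k ≤ q) :
    IsSucc.{v} K v (betaB u v w k q) (gammaA u v w k (q + 1)) := by
  -- A predecessor of the `betaA` row along v: for q = 0 the bound k ≤ q forces k = 0, and it is the
  -- one-term sequence.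
  obtain ⟨s, hs⟩ : ∃ s, IsSucc.{v} K v s (betaA u v w k q) := by
    cases q with
    | zero => obtain rfl : k = 0 := by omega
              exact ⟨_, oddA_betaA K h 0⟩
    | succ q => exact ⟨_, betaB_betaA K h.rotate.rotate k q⟩
  exact IsSucc.replace h.swap.rotate.swap hs (betaA_betaB K h k q) (betaA_gammaB K h k q)
    (gammaB_gammaA K h.rotate.rotate k q)

/-- The rows for (u, v, w) and (u, w, v) are linked by the paths uvu and uwu from the preceding odd
rows, so equality in every representation propagates from k = 0. -/
theorem oddA_oddB_swap (k : ℕ) {u v w : Fin 3} (h : IsTriple u v w) :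
    (∀ (V : Type v) [AddCommGroup V] [Module K V] (ρ : Representation K V) (c : Fin 3),
      ρ (oddA u v w k c) = ρ (oddA u w v k c)) ∧
    ∀ (V : Type v) [AddCommGroup V] [Module K V] (ρ : Representation K V) (c : Fin 3),
      ρ (oddB u v w k c) = ρ (oddB u w v k c) := by
  induction k with
  | zero =>
    exact ⟨fun V _ _ ρ c => by rw [oddA_zero_swap], fun V _ _ ρ c => by rw [oddB_zero_swap h]⟩
  | succ k ih =>
    have hA := IsSucc.apply_eq h (betaA_oddB K h k) (oddB_gammaA K h k) (gammaA_oddA K h k)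
      (oddB_gammaA K h.swap k) (gammaA_oddA K h.swap k) ih.2
    exact ⟨hA, IsSucc.apply_eq h (gammaA_oddA K h k) (oddA_betaA K h (k + 1))
      (betaA_oddB K h (k + 1)) (oddA_betaA K h.swap (k + 1)) (betaA_oddB K h.swap (k + 1)) hA⟩

theorem oddA_betaA_swap (h : IsTriple u v w) (k : ℕ) :
    IsSucc.{v} K w (oddA u v w k) (betaA u w v k k) := by
  intro V _ _ ρ c
  rw [(oddA_oddB_swap K k h).1 _ ρ.coxeter]
  exact oddA_betaA K h.swap k V ρ c

theorem oddB_gammaA_swap (h : IsTriple u v w) (k : ℕ) :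
    IsSucc.{v} K w (oddB u v w k) (gammaA u w v k (k + 1)) := by
  intro V _ _ ρ c
  rw [(oddA_oddB_swap K k h).2 _ ρ.coxeter]
  exact oddB_gammaA K h.swap k V ρ c

end
-- Values by length and starting index
/-- In the `m`-fold cyclic shift `(i, j, l)` of a triple, the triple begins with `t`. -/
def Start (t : Fin 3) : ℕ → Fin 3 → Fin 3 → Fin 3 → Prop
  | 0, i, _, _ => i = t
  | m + 1, i, j, l => Start t m j l i

theorem start_three_mul (t : Fin 3) (p : ℕ) (i j l : Fin 3) : Start t (3 * p) i j l ↔ i = t := by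
  induction p with
  | zero => exact Iff.rfl
  | succ p ih => exact ih

/-- The values at the admissible sequences of length `n` that start at `t`. -/
inductive Level (t : Fin 3) : ℕ → (Fin 3 → D222) → Prop
  | gammaA {i j l : Fin 3} (h : IsTriple i j l) (k m : ℕ) (hm : Start t m i j l) :
      Level t (4 * k + 2 * m + 4) (gammaA i j l k (k + m + 1))
  | gammaB {i j l : Fin 3} (h : IsTriple i j l) (k m : ℕ) (hm : Start t m i j l) :
      Level t (4 * k + 2 * m + 5) (gammaB i j l k (k + m + 1))
  | betaA {i j l : Fin 3} (h : IsTriple i j l) (k m : ℕ) (hm : Start t m i j l) :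
      Level t (4 * k + 2 * m + 2) (betaA i j l k (k + m))
  | betaB {i j l : Fin 3} (h : IsTriple i j l) (k m : ℕ) (hm : Start t m i j l) :
      Level t (4 * k + 2 * m + 3) (betaB i j l k (k + m))
  | oddA {j l : Fin 3} (h : IsTriple t j l) (k : ℕ) : Level t (4 * k + 1) (oddA t j l k)
  | oddB {j l : Fin 3} (h : IsTriple t j l) (k : ℕ) : Level t (4 * k + 3) (oddB t j l k)

theorem Level.cast {t : Fin 3} {n n' : ℕ} {s s' : Fin 3 → D222} (H : Level t n s) (hn : n = n')
    (hs : s = s') : Level t n' s' := hn ▸ hs ▸ H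

variable {t : Fin 3} {n : ℕ} {s : Fin 3 → D222} (K : Type*) [Field K]

/-- The index i is the front of the sequence, which may not be repeated; j and l are the two
admissible continuations. -/
theorem Level.exists_succ (H : Level t n s) : ∃ i j l s' s'', IsTriple i j l ∧
    Level t (n + 1) s' ∧ Level t (n + 1) s'' ∧ IsSucc.{v} K j s s' ∧ IsSucc.{v} K l s s'' := by
  cases H with
  | @gammaA i j l h k m hm =>
    have h1 : Level t (4 * k + 2 * m + 4 + 1) (D222.gammaB i j l k (k + m + 1)) :=
      .gammaB h k m hm
    -- At m = 0 the continuation by i is an odd row; otherwise k grows by one and the shift count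
    -- drops by one.
    cases m with
    | zero =>
      obtain rfl : i = t := hm
      exact ⟨j, l, i, _, _, h.rotate.rotate, h1, (Level.oddA h (k + 1)).cast (by omega) rfl,
        gammaA_gammaB K h k _, gammaA_oddA K h k⟩
    | succ m =>
      exact ⟨j, l, i, _, _, h.rotate.rotate, h1,
        (Level.betaB h.rotate.rotate (k + 1) m hm).cast (by omega) rfl,
        gammaA_gammaB K h k _, by
          rw [show k + 1 + m = k + (m + 1) by omega]; exact gammaA_betaB K h k (k + (m + 1))⟩
  | @gammaB i j l h k m hm =>
    exact ⟨l, i, j, _, _, h.rotate, (Level.gammaA h.rotate k (m + 1) hm).cast (by omega) rfl,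
      (Level.betaA h (k + 1) m hm).cast (by omega) rfl, gammaB_gammaA K h k (k + m + 1), by
        rw [show k + 1 + m = k + m + 1 by omega]; exact gammaB_betaA K h k (k + m)⟩
  | @betaA i j l h k m hm =>
    have h1 : Level t (4 * k + 2 * m + 2 + 1) (D222.betaB i j l k (k + m)) := .betaB h k m hm
    cases m with
    | zero =>
      obtain rfl : i = t := hm
      exact ⟨j, l, i, _, _, h.rotate.rotate, h1, (Level.oddB h k).cast (by omega) rfl,
        betaA_betaB K h k _, betaA_oddB K h k⟩
    | succ m =>
      exact ⟨j, l, i, _, _, h.rotate.rotate, h1,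
        (Level.gammaB h.rotate.rotate k m hm).cast (by omega) rfl,
        betaA_betaB K h k _, betaA_gammaB K h k (k + m + 1)⟩
  | @betaB i j l h k m hm =>
    exact ⟨l, i, j, _, _, h.rotate, (Level.betaA h.rotate k (m + 1) hm).cast (by omega) rfl,
      (Level.gammaA h k m hm).cast (by omega) rfl, betaB_betaA K h k (k + m),
      betaB_gammaA K h k (k + m) (by omega)⟩
  | @oddA j l h k =>
    exact ⟨t, j, l, _, _, h, (Level.betaA h k 0 rfl).cast (by omega) rfl,
      (Level.betaA h.swap k 0 rfl).cast (by omega) rfl, oddA_betaA K h k, oddA_betaA_swap K h k⟩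
  | @oddB j l h k =>
    exact ⟨t, j, l, _, _, h, (Level.gammaA h k 0 rfl).cast (by omega) rfl,
      (Level.gammaA h.swap k 0 rfl).cast (by omega) rfl, oddB_gammaA K h k,
      oddB_gammaA_swap K h k⟩

/-- Every row except the one-term sequence has a predecessor; `hn` excludes exactly that case. -/
theorem Level.exists_pred (H : Level t (n + 1) s) (hn : 1 ≤ n) :
    ∃ i s', Level t n s' ∧ IsSucc.{v} K i s' s := by
  generalize hN : n + 1 = N at H
  cases H with
  | @gammaA i j l h k m hm =>
    exact ⟨j, _, (Level.betaB h k m hm).cast (by omega) rfl, betaB_gammaA K h k (k + m) (by omega)⟩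
  | @gammaB i j l h k m hm =>
    exact ⟨l, _, (Level.gammaA h k m hm).cast (by omega) rfl, gammaA_gammaB K h k _⟩
  | @betaA i j l h k m hm =>
    cases m with
    | zero =>
      obtain rfl : i = t := hm
      exact ⟨j, _, (Level.oddA h k).cast (by omega) rfl, oddA_betaA K h k⟩
    | succ m =>
      exact ⟨j, _, (Level.betaB h.rotate.rotate k m hm).cast (by omega) rfl,
        betaB_betaA K h.rotate.rotate k (k + m)⟩
  | @betaB i j l h k m hm =>
    exact ⟨l, _, (Level.betaA h k m hm).cast (by omega) rfl, betaA_betaB K h k _⟩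
  | @oddA j l h k =>
    cases k with
    | zero => omega
    | succ k =>
      exact ⟨t, _, (Level.gammaA h k 0 rfl).cast (by omega) rfl, gammaA_oddA K h k⟩
  | @oddB j l h k =>
    exact ⟨t, _, (Level.betaA h k 0 rfl).cast (by omega) rfl, betaA_oddB K h k⟩

/-! ### The rows of the table -/

/-- The elements `f_α`, `e_α`, `g_{α0}`. -/
def AdmissibleData.values (d : AdmissibleData) : Fin 3 → D222 := ![d.f, d.e, d.g]

section rows

theorem power_succ (r : List (Fin 3)) (m : ℕ) : power r (m + 1) = r ++ power r m := by
  simp [power, List.replicate_succ]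

theorem exists_cons_power {u v w : Fin 3} (h : IsTriple u v w) (p r : ℕ) :
    ∃ l, power [v, u, w] p ++ power [v, u] (r + 1) = v :: l ∧ IsAdmissible (v :: l) ∧
      (v :: l).getLast? = some u := by
  induction p with
  | zero =>
    refine ⟨u :: power [v, u] r, by rw [power_succ]; rfl, ?_, ?_⟩
    · exact List.isChain_cons_cons.2 ⟨h.1.symm, isChain_power h.1 r⟩
    · rw [List.getLast?_cons_cons, getLast_power]
  | succ p ih =>
    obtain ⟨l, h1, h2, h3⟩ := ih
    refine ⟨u :: w :: v :: l, by rw [power_succ, List.append_assoc, h1]; rfl, ?_, ?_⟩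
    · exact List.isChain_cons_cons.2 ⟨h.1.symm, List.isChain_cons_cons.2 ⟨h.2.1,
        List.isChain_cons_cons.2 ⟨h.2.2.symm, h2⟩⟩⟩
    · simpa [List.getLast?_cons_cons] using h3

theorem table_α {u v w : Fin 3} (h : IsTriple u v w) (k p : ℕ) (N : Fin 14)
    (hk : (N : ℕ) < 6 → 0 < k) :
    IsAdmissible (table u v w k p N).α ∧ (table u v w k p N).α.getLast? = some u := by
  have huv := h.1
  have huw := h.2.1
  have hvw := h.2.2
  have hγ : 0 < k → ∃ l, power [v, u, w] (2 * p) ++ power [v, u] (2 * k) = v :: l ∧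
      IsAdmissible (v :: l) ∧ (v :: l).getLast? = some u := fun hk => by
    obtain ⟨r, hr⟩ : ∃ r, 2 * k = r + 1 := ⟨2 * k - 1, by omega⟩
    rw [hr]; exact exists_cons_power h _ r
  have hβ := exists_cons_power h (2 * p) (2 * k)
  have h6 (m : ℕ) : IsAdmissible ([u] ++ power [v, u] m) ∧
    ([u] ++ power [v, u] m).getLast? = some u := ⟨isChain_power h.1 m, getLast_power u v m⟩
  have hw {l : List (Fin 3)} (H : IsAdmissible (v :: l)) : IsAdmissible (w :: v :: l) :=
    List.isChain_cons_cons.2 ⟨h.2.2.symm, H⟩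
  have hu {l : List (Fin 3)} (H : IsAdmissible (w :: l)) : IsAdmissible (u :: w :: l) :=
    List.isChain_cons_cons.2 ⟨h.2.1, H⟩
  have hv {l : List (Fin 3)} (H : IsAdmissible (u :: l)) : IsAdmissible (v :: u :: l) :=
    List.isChain_cons_cons.2 ⟨h.1.symm, H⟩
  let Q : List (Fin 3) → Prop := fun L => IsAdmissible L ∧ L.getLast? = some u
  have key : ∀ δ : List (Fin 3), (∃ l, δ = v :: l ∧ IsAdmissible (v :: l) ∧
      (v :: l).getLast? = some u) → Q δ ∧ Q ([w] ++ δ) ∧ Q ([u, w] ++ δ) ∧ Q ([v, u, w] ++ δ) ∧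
        Q ([w, v, u, w] ++ δ) ∧ Q ([u, w, v, u, w] ++ δ) := by
    rintro _ ⟨l, rfl, h1, h2⟩
    exact ⟨⟨h1, h2⟩, ⟨hw h1, h2⟩, ⟨hu (hw h1), h2⟩, ⟨hv (hu (hw h1)), h2⟩,
      ⟨hw (hv (hu (hw h1))), h2⟩, ⟨hu (hw (hv (hu (hw h1)))), h2⟩⟩
  have H := key _ hβ
  match N, hk with
  | 0, hk => exact (key _ (hγ (hk (by decide)))).1
  | 1, hk => exact (key _ (hγ (hk (by decide)))).2.1
  | 2, hk => exact (key _ (hγ (hk (by decide)))).2.2.1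
  | 3, hk => exact (key _ (hγ (hk (by decide)))).2.2.2.1
  | 4, hk => exact (key _ (hγ (hk (by decide)))).2.2.2.2.1
  | 5, hk => exact (key _ (hγ (hk (by decide)))).2.2.2.2.2
  | 6, _ => exact h6 _
  | 7, _ => exact h6 _
  | 8, _ => exact H.1
  | 9, _ => exact H.2.1
  | 10, _ => exact H.2.2.1
  | 11, _ => exact H.2.2.2.1
  | 12, _ => exact H.2.2.2.2.1
  | 13, _ => exact H.2.2.2.2.2

theorem length_γ (u v w : Fin 3) (k p : ℕ) :
    (power [v, u, w] (2 * p) ++ power [v, u] (2 * k)).length = 4 * k + 6 * p := by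
  simp [length_power]; ring

theorem length_β (u v w : Fin 3) (k p : ℕ) :
    (power [v, u, w] (2 * p) ++ power [v, u] (2 * k + 1)).length = 4 * k + 6 * p + 2 := by
  simp [length_power]; ring

/-- The sequence of `d` has length `n`, and its elements are `s`. -/
def IsRow (d : AdmissibleData) (n : ℕ) (s : Fin 3 → D222) : Prop := d.α.length = n ∧ d.values = s

theorem IsRow.level {d : AdmissibleData} {t : Fin 3} {n : ℕ} {s : Fin 3 → D222}
    (H : IsRow d n s) (h : Level t n s) : Level t d.α.length d.values :=
  h.cast H.1.symm H.2.symm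

variable (u v w : Fin 3) (k p : ℕ)

theorem isRow_0 : IsRow (table u v w (k + 1) p 0) (4 * k + 2 * (3 * p) + 4)
    (gammaA u v w k (k + 3 * p + 1)) := by
  refine ⟨(congrArg (· + 0) (length_γ u v w (k + 1) p)).trans (by omega), ?_⟩
  rw [show k + 3 * p + 1 = k + 1 + 3 * p by omega]
  rfl

theorem isRow_1 : IsRow (table u v w (k + 1) p 1) (4 * k + 2 * (3 * p) + 5)
    (gammaB u v w k (k + 3 * p + 1)) := by
  refine ⟨(congrArg (· + 1) (length_γ u v w (k + 1) p)).trans (by omega), ?_⟩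
  rw [show k + 3 * p + 1 = k + 1 + 3 * p by omega]
  rfl

theorem isRow_2 : IsRow (table u v w (k + 1) p 2) (4 * k + 2 * (3 * p + 1) + 4)
    (gammaA w u v k (k + (3 * p + 1) + 1)) := by
  refine ⟨(congrArg (· + 2) (length_γ u v w (k + 1) p)).trans (by omega), ?_⟩
  rw [show k + (3 * p + 1) + 1 = k + 1 + 3 * p + 1 by omega]
  rfl

theorem isRow_3 : IsRow (table u v w (k + 1) p 3) (4 * k + 2 * (3 * p + 1) + 5)
    (gammaB w u v k (k + (3 * p + 1) + 1)) := by
  refine ⟨(congrArg (· + 3) (length_γ u v w (k + 1) p)).trans (by omega), ?_⟩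
  rw [show k + (3 * p + 1) + 1 = k + 1 + 3 * p + 1 by omega]
  rfl

theorem isRow_4 : IsRow (table u v w (k + 1) p 4) (4 * k + 2 * (3 * p + 2) + 4)
    (gammaA v w u k (k + (3 * p + 2) + 1)) := by
  refine ⟨(congrArg (· + 4) (length_γ u v w (k + 1) p)).trans (by omega), ?_⟩
  rw [show k + (3 * p + 2) + 1 = k + 1 + 3 * p + 2 by omega]
  rfl

theorem isRow_5 : IsRow (table u v w (k + 1) p 5) (4 * k + 2 * (3 * p + 2) + 5)
    (gammaB v w u k (k + (3 * p + 2) + 1)) := by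
  refine ⟨(congrArg (· + 5) (length_γ u v w (k + 1) p)).trans (by omega), ?_⟩
  rw [show k + (3 * p + 2) + 1 = k + 1 + 3 * p + 2 by omega, gammaB, inf_comm (y w) (y u)]
  rfl

theorem isRow_8 : IsRow (table u v w k p 8) (4 * k + 2 * (3 * p) + 2)
    (betaA u v w k (k + 3 * p)) := by
  refine ⟨(congrArg (· + 0) (length_β u v w k p)).trans (by omega), ?_⟩
  rw [show k + 3 * p = k + 3 * p by omega]
  rfl

theorem isRow_9 : IsRow (table u v w k p 9) (4 * k + 2 * (3 * p) + 3)
    (betaB u v w k (k + 3 * p)) := by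
  refine ⟨(congrArg (· + 1) (length_β u v w k p)).trans (by omega), ?_⟩
  rw [show k + 3 * p = k + 3 * p by omega]
  rfl

theorem isRow_10 : IsRow (table u v w k p 10) (4 * k + 2 * (3 * p + 1) + 2)
    (betaA w u v k (k + (3 * p + 1))) := by
  refine ⟨(congrArg (· + 2) (length_β u v w k p)).trans (by omega), ?_⟩
  rw [show k + (3 * p + 1) = k + 3 * p + 1 by omega]
  rfl

theorem isRow_11 : IsRow (table u v w k p 11) (4 * k + 2 * (3 * p + 1) + 3)
    (betaB w u v k (k + (3 * p + 1))) := by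
  refine ⟨(congrArg (· + 3) (length_β u v w k p)).trans (by omega), ?_⟩
  rw [show k + (3 * p + 1) = k + 3 * p + 1 by omega, betaB, inf_comm (y w) (y v)]
  rfl

theorem isRow_12 : IsRow (table u v w k p 12) (4 * k + 2 * (3 * p + 2) + 2)
    (betaA v w u k (k + (3 * p + 2))) := by
  refine ⟨(congrArg (· + 4) (length_β u v w k p)).trans (by omega), ?_⟩
  rw [show k + (3 * p + 2) = k + 3 * p + 2 by omega]
  rfl

theorem isRow_13 : IsRow (table u v w k p 13) (4 * k + 2 * (3 * p + 2) + 3)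
    (betaB v w u k (k + (3 * p + 2))) := by
  refine ⟨(congrArg (· + 5) (length_β u v w k p)).trans (by omega), ?_⟩
  rw [show k + (3 * p + 2) = k + 3 * p + 2 by omega, betaB, inf_comm (y v) (y u)]
  rfl

theorem isRow_6 : IsRow (table u v w k p 6) (4 * k + 1) (oddA u v w k) := by
  refine ⟨?_, rfl⟩
  change ([u] ++ power [v, u] (2 * k)).length = _
  simp [length_power]; ring

theorem isRow_7 : IsRow (table u v w k p 7) (4 * k + 3) (oddB u v w k) := by
  refine ⟨?_, rfl⟩
  change ([u] ++ power [v, u] (2 * k + 1)).length = _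
  simp [length_power]; ring

variable {u v w}

theorem level_table (h : IsTriple u v w) (N : Fin 14) (hk : (N : ℕ) < 6 → 0 < k) :
    Level u (table u v w k p N).α.length (table u v w k p N).values := by
  have hs := (start_three_mul u p u v w).2 rfl
  have hs1 : Start u (3 * p + 1) w u v := hs
  have hs2 : Start u (3 * p + 2) v w u := hs
  have hγ (N : Fin 14) (hk : 0 < k) (H : ∀ k, Level u (table u v w (k + 1) p N).α.length
      (table u v w (k + 1) p N).values) :
      Level u (table u v w k p N).α.length (table u v w k p N).values := by
    obtain ⟨k, rfl⟩ : ∃ k', k = k' + 1 := ⟨k - 1, by omega⟩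
    exact H k
  match N, hk with
  | 0, hk => exact hγ 0 (hk (by decide)) fun k => (isRow_0 u v w k p).level (.gammaA h k _ hs)
  | 1, hk => exact hγ 1 (hk (by decide)) fun k => (isRow_1 u v w k p).level (.gammaB h k _ hs)
  | 2, hk => exact hγ 2 (hk (by decide)) fun k => (isRow_2 u v w k p).level (.gammaA h.rotate k _ hs1)
  | 3, hk => exact hγ 3 (hk (by decide)) fun k => (isRow_3 u v w k p).level (.gammaB h.rotate k _ hs1)
  | 4, hk => exact hγ 4 (hk (by decide)) fun k => (isRow_4 u v w k p).level (.gammaA h.rotate.rotate k _ hs2)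
  | 5, hk => exact hγ 5 (hk (by decide)) fun k => (isRow_5 u v w k p).level (.gammaB h.rotate.rotate k _ hs2)
  | 6, _ => exact (isRow_6 u v w k p).level (.oddA h k)
  | 7, _ => exact (isRow_7 u v w k p).level (.oddB h k)
  | 8, _ => exact (isRow_8 u v w k p).level (.betaA h k _ hs)
  | 9, _ => exact (isRow_9 u v w k p).level (.betaB h k _ hs)
  | 10, _ => exact (isRow_10 u v w k p).level (.betaA h.rotate k _ hs1)
  | 11, _ => exact (isRow_11 u v w k p).level (.betaB h.rotate k _ hs1)
  | 12, _ => exact (isRow_12 u v w k p).level (.betaA h.rotate.rotate k _ hs2)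
  | 13, _ => exact (isRow_13 u v w k p).level (.betaB h.rotate.rotate k _ hs2)

/-- Three shifts are the identity, so m mod 3 selects the block of rows in the table and m / 3 is
its exponent p. -/
theorem Start.exists_eq {t i j l : Fin 3} {m : ℕ} (H : Start t m i j l) :
    ∃ p, m = 3 * p ∧ i = t ∨ m = 3 * p + 1 ∧ j = t ∨ m = 3 * p + 2 ∧ l = t := by
  refine ⟨m / 3, ?_⟩
  have h3 : m % 3 = 0 ∨ m % 3 = 1 ∨ m % 3 = 2 := by omega
  rcases h3 with h3 | h3 | h3
  · have hm : m = 3 * (m / 3) := by omega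
    rw [hm, start_three_mul] at H
    exact Or.inl ⟨hm, H⟩
  · have hm : m = 3 * (m / 3) + 1 := by omega
    rw [hm, Start, start_three_mul] at H
    exact Or.inr (Or.inl ⟨hm, H⟩)
  · have hm : m = 3 * (m / 3) + 2 := by omega
    rw [hm, Start, Start, start_three_mul] at H
    exact Or.inr (Or.inr ⟨hm, H⟩)

theorem exists_tableEntry {t : Fin 3} {n : ℕ} {s : Fin 3 → D222} (H : Level t n s) :
    ∃ v w k p, ∃ N : Fin 14, IsTriple t v w ∧ ((N : ℕ) < 6 → 0 < k) ∧
      ((N : ℕ) = 6 ∨ (N : ℕ) = 7 → p = 0) ∧ IsRow (table t v w k p N) n s := by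
  cases H with
  | @gammaA i j l h k m hm =>
    obtain ⟨p, ⟨rfl, rfl⟩ | ⟨rfl, rfl⟩ | ⟨rfl, rfl⟩⟩ := hm.exists_eq
    · exact ⟨j, l, k + 1, p, 0, h, by simp, by simp, isRow_0 i j l k p⟩
    · exact ⟨l, i, k + 1, p, 2, h.rotate.rotate, by simp, by simp, isRow_2 j l i k p⟩
    · exact ⟨i, j, k + 1, p, 4, h.rotate, by simp, by simp, isRow_4 l i j k p⟩
  | @gammaB i j l h k m hm =>
    obtain ⟨p, ⟨rfl, rfl⟩ | ⟨rfl, rfl⟩ | ⟨rfl, rfl⟩⟩ := hm.exists_eq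
    · exact ⟨j, l, k + 1, p, 1, h, by simp, by simp, isRow_1 i j l k p⟩
    · exact ⟨l, i, k + 1, p, 3, h.rotate.rotate, by simp, by simp, isRow_3 j l i k p⟩
    · exact ⟨i, j, k + 1, p, 5, h.rotate, by simp, by simp, isRow_5 l i j k p⟩
  | @betaA i j l h k m hm =>
    obtain ⟨p, ⟨rfl, rfl⟩ | ⟨rfl, rfl⟩ | ⟨rfl, rfl⟩⟩ := hm.exists_eq
    · exact ⟨j, l, k, p, 8, h, by simp, by simp, isRow_8 i j l k p⟩
    · exact ⟨l, i, k, p, 10, h.rotate.rotate, by simp, by simp, isRow_10 j l i k p⟩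
    · exact ⟨i, j, k, p, 12, h.rotate, by simp, by simp, isRow_12 l i j k p⟩
  | @betaB i j l h k m hm =>
    obtain ⟨p, ⟨rfl, rfl⟩ | ⟨rfl, rfl⟩ | ⟨rfl, rfl⟩⟩ := hm.exists_eq
    · exact ⟨j, l, k, p, 9, h, by simp, by simp, isRow_9 i j l k p⟩
    · exact ⟨l, i, k, p, 11, h.rotate.rotate, by simp, by simp, isRow_11 j l i k p⟩
    · exact ⟨i, j, k, p, 13, h.rotate, by simp, by simp, isRow_13 l i j k p⟩
  | @oddA j l h k => exact ⟨j, l, k, 0, 6, h, by simp, by simp, isRow_6 t j l k 0⟩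
  | @oddB j l h k => exact ⟨j, l, k, 0, 7, h, by simp, by simp, isRow_7 t j l k 0⟩

end rows
-- The summands of the cumulative polynomials as levels
theorem IsTriple.of_perm (σ : Equiv.Perm (Fin 3)) : IsTriple (σ 0) (σ 1) (σ 2) := by
  refine ⟨?_, ?_, ?_⟩ <;> exact fun h => by simpa using σ.injective h

theorem IsTriple.exists_perm {u v w : Fin 3} (h : IsTriple u v w) :
    ∃ σ : Equiv.Perm (Fin 3), σ 0 = u ∧ σ 1 = v ∧ σ 2 = w := by
  revert u v w; unfold IsTriple; decide

theorem SeqEquiv.getLast?_eq {α β : List (Fin 3)} (h : SeqEquiv α β) :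
    α.getLast? = β.getLast? := by
  induction h with
  | rel _ _ h => cases h; simp [List.getLast?_append, List.getLast?_cons]
  | refl => rfl
  | symm _ _ _ h => exact h.symm
  | trans _ _ _ _ _ h k => exact h.trans k

/-- Length and starting index are invariant under replacement, so they can be read off the normal
form. -/
theorem AdmissibleElements.level {α : List (Fin 3)} {f e g : D222} {t : Fin 3}
    (H : AdmissibleElements α f e g) (ht : α.getLast? = some t) : Level t α.length ![f, e, g] := by
  obtain ⟨-, _, ⟨σ, k, p, N, hk, -, rfl⟩, hα, rfl, rfl, rfl⟩ := H
  have h := IsTriple.of_perm σ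
  have h0 := hα.getLast?_eq.symm.trans ht
  rw [(table_α h k p N hk).2, Option.some_inj] at h0
  rw [hα.length_eq]
  subst h0
  exact level_table k p h N hk

theorem Level.admissibleElements {t : Fin 3} {n : ℕ} {s : Fin 3 → D222} (H : Level t n s) :
    ∃ α, AdmissibleElements α (s 0) (s 1) (s 2) ∧ α.length = n ∧ α.getLast? = some t := by
  obtain ⟨v, w, k, p, N, h, hk, hp, hn, rfl⟩ := exists_tableEntry H
  obtain ⟨σ, rfl, rfl, rfl⟩ := h.exists_perm
  obtain ⟨h1, h2⟩ := table_α h k p N hk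
  exact ⟨_, ⟨h1, _, ⟨σ, k, p, N, hk, hp, rfl⟩, Relation.EqvGen.refl _, rfl, rfl, rfl⟩, hn, h2⟩

theorem fSet_eq (t : Fin 3) (n : ℕ) : fSet t n = {z | ∃ s, Level t n s ∧ s 0 = z} := by
  ext z
  constructor
  · rintro ⟨α, e, g, h, rfl, ht⟩
    exact ⟨_, h.level ht, rfl⟩
  · rintro ⟨s, h, rfl⟩
    obtain ⟨α, h1, h2, h3⟩ := h.admissibleElements
    exact ⟨α, _, _, h1, h2, h3⟩

theorem eSet_eq (t : Fin 3) (n : ℕ) : eSet t n = {z | ∃ s, Level t n s ∧ s 1 = z} := by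
  ext z
  constructor
  · rintro ⟨α, e, g, h, rfl, ht⟩
    exact ⟨_, h.level ht, rfl⟩
  · rintro ⟨s, h, rfl⟩
    obtain ⟨α, h1, h2, h3⟩ := h.admissibleElements
    exact ⟨α, _, _, h1, h2, h3⟩

theorem gSet_succ_eq {n : ℕ} (hn : 1 ≤ n) :
    gSet (n + 1) = {z | ∃ s, (∃ t, Level t n s) ∧ s 2 = z} := by
  ext z
  constructor
  · rintro (⟨h, -⟩ | ⟨α, f, e, h, hl⟩)
    · omega
    · obtain rfl : α.length = n := by omega
      obtain ⟨t, ht⟩ : ∃ t, α.getLast? = some t :=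
        Option.isSome_iff_exists.1 (by
          rw [List.getLast?_isSome]; rintro rfl; simp at hn)
      exact ⟨_, ⟨t, h.level ht⟩, rfl⟩
  · rintro ⟨s, ⟨t, h⟩, rfl⟩
    obtain ⟨α, h1, h2, -⟩ := h.admissibleElements
    exact Or.inr ⟨α, _, _, h1, by omega⟩

theorem Level.one_le {t : Fin 3} {n : ℕ} {s : Fin 3 → D222} (H : Level t n s) : 1 ≤ n := by
  cases H <;> omega

/-- No sequence in the table is empty, so only g₀ contributes. -/
theorem gSet_one : gSet 1 = {⊤} := by
  ext z
  constructor
  · rintro (⟨-, rfl⟩ | ⟨α, f, e, ⟨-, _, ⟨σ, k, p, N, hk, -, rfl⟩, hα, -⟩, hl⟩)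
    · rfl
    · have := (level_table k p (IsTriple.of_perm σ) N hk).one_le
      rw [← hα.length_eq] at this
      omega
  · rintro rfl
    exact Or.inl ⟨rfl, rfl⟩

theorem level_one {t : Fin 3} {s : Fin 3 → D222} (H : Level t 1 s) :
    ∃ j l, IsTriple t j l ∧ s = oddA t j l 0 := by
  generalize hN : 1 = N at H
  cases H with
  | @oddA j l h k =>
    obtain rfl : k = 0 := by omega
    exact ⟨j, l, h, rfl⟩
  | _ => omega

/-! ### Summation over a level -/

namespace Representation

variable {K : Type*} {V : Type v} [Field K] [AddCommGroup V] [Module K V] (ρ : Representation K V)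

theorem apply_sum (S : Set D222) (hS : S.Finite) (hne : S.Nonempty) :
    ρ (sum S hS hne) = ⨆ z ∈ S, ρ z := by
  rw [sum]
  refine (Finset.apply_sup'_eq_sup'_comp _ ρ.toHom (fun b c => map_sup ρ.toHom b c)).trans ?_
  rw [Finset.sup'_eq_sup, Finset.sup_eq_iSup]
  simp

/-- If every `s` with `P s` has successors with `Q` under two of the maps `φᵢ`, and every `s` with
`Q s` is a successor, then the maps `φᵢ` send the sum over `P` to the sum over `Q`. -/
theorem iSup_map_phi {P Q : (Fin 3 → D222) → Prop} (c : Fin 3)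
    (hP : ∀ s, P s → ∃ i j l s' s'', IsTriple i j l ∧ Q s' ∧ Q s'' ∧ IsSucc.{v} K j s s' ∧
      IsSucc.{v} K l s s'')
    (hQ : ∀ s, Q s → ∃ i s', P s' ∧ IsSucc.{v} K i s' s) {S T : Set D222}
    (hS : S = {z | ∃ s, P s ∧ s c = z}) (hT : T = {z | ∃ s, Q s ∧ s c = z})
    (fS : S.Finite) (nS : S.Nonempty) (fT : T.Finite) (nT : T.Nonempty) :
    (⨆ i : Fin 3, (ρ.coxeter (sum S fS nS)).map (ρ.phi i)) = ρ (sum T fT nT) := by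
  rw [apply_sum, apply_sum]
  subst hS hT
  refine le_antisymm (iSup_le fun r => ?_) (iSup₂_le ?_)
  · rw [Submodule.map_iSup]
    refine iSup_le fun z => ?_
    rw [Submodule.map_iSup]
    refine iSup_le ?_
    rintro ⟨s, hs, rfl⟩
    obtain ⟨i, j, l, s', s'', h, h', h'', H', H''⟩ := hP s hs
    have e' : (ρ.coxeter (s c)).map (ρ.phi j) ≤ ⨆ z ∈ {z | ∃ s, Q s ∧ s c = z}, ρ z :=
      (H' V ρ c).trans_le (le_iSup₂ (f := fun z (_ : z ∈ {z | ∃ s, Q s ∧ s c = z}) => ρ z)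
        (s' c) ⟨s', h', rfl⟩)
    have e'' : (ρ.coxeter (s c)).map (ρ.phi l) ≤ ⨆ z ∈ {z | ∃ s, Q s ∧ s c = z}, ρ z :=
      (H'' V ρ c).trans_le (le_iSup₂ (f := fun z (_ : z ∈ {z | ∃ s, Q s ∧ s c = z}) => ρ z)
        (s'' c) ⟨s'', h'', rfl⟩)
    rcases h.eq_or r with rfl | rfl | rfl
    -- The index without a chosen successor: its image lies in the sum of the other two.
    · exact (ρ.map_phi_le_sup h _).trans (sup_le e' e'')
    · exact e'
    · exact e''
  · rintro z ⟨s, hs, rfl⟩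
    obtain ⟨i, s', h', H⟩ := hQ s hs
    refine le_trans ?_ (le_iSup _ i)
    rw [← H V ρ c]
    exact Submodule.map_mono
      (le_iSup₂ (f := fun z (_ : z ∈ {z | ∃ s, P s ∧ s c = z}) => ρ.coxeter z) _ ⟨s', h', rfl⟩)

/-- The passage from x₀(1) = I to x₀(2): φᵢ(X₀¹) = Yᵢ ∩ (Yⱼ + Yₖ), which is the value of g at the
one-term sequence i. -/
theorem iSup_map_phi_top {T : Set D222}
    (hT : T = {z | ∃ s, (∃ t, Level t 1 s) ∧ s 2 = z}) (fT : T.Finite) (nT : T.Nonempty) :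
    (⨆ i : Fin 3, (⊤ : Submodule K ρ.coxeterSpace).map (ρ.phi i)) = ρ (sum T fT nT) := by
  have key {i j l : Fin 3} (h : IsTriple i j l) :
      (⊤ : Submodule K ρ.coxeterSpace).map (ρ.phi i) = ρ (oddA i j l 0 2) := by
    have := ρ.map_phi_fst_box h ⊤ ⊤ ⊤
    simp only [box, ρ.map_top, Submodule.comap_top, inf_top_eq] at this
    rw [this]
    simp [oddA, values, a_zero, A_zero]
  rw [apply_sum]
  subst hT
  refine le_antisymm (iSup_le fun i => ?_) (iSup₂_le ?_)
  · obtain ⟨j, l, h⟩ : ∃ j l, IsTriple i j l := by revert i; unfold IsTriple; decide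
    rw [key h]
    exact le_iSup₂ (f := fun z (_ : z ∈ {z | ∃ s, (∃ t, Level t 1 s) ∧ s 2 = z}) => ρ z) _
      ⟨_, ⟨i, Level.oddA h 0⟩, rfl⟩
  · rintro z ⟨s, ⟨t, hs⟩, rfl⟩
    obtain ⟨j, l, h, rfl⟩ := level_one hs
    rw [← key h]
    exact le_iSup (fun i => (⊤ : Submodule K ρ.coxeterSpace).map (ρ.phi i)) t

end Representation
end D222

theorem mainTheorem9 {K V : Type*} [Field K] [AddCommGroup V] [Module K V]
    (ρ : D222.Representation K V) (n : ℕ) (hn : 1 ≤ n) :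
    (∀ t : Fin 3,
      (⨆ i : Fin 3, (ρ.coxeter (D222.cumX t n hn)).map (ρ.phi i)) =
        ρ (D222.cumX t (n + 1) (Nat.le_add_left 1 n))) ∧
    (∀ t : Fin 3,
      (⨆ i : Fin 3, (ρ.coxeter (D222.cumY t n hn)).map (ρ.phi i)) =
        ρ (D222.cumY t (n + 1) (Nat.le_add_left 1 n))) ∧
    (⨆ i : Fin 3, (ρ.coxeter (D222.cumX0 n hn)).map (ρ.phi i)) =
      ρ (D222.cumX0 (n + 1) (Nat.le_add_left 1 n)) := by
  refine ⟨fun t => ?_, fun t => ?_, ?_⟩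
  · exact ρ.iSup_map_phi 0 (fun _ h => h.exists_succ K) (fun _ h => h.exists_pred K hn)
      (D222.fSet_eq t n) (D222.fSet_eq t (n + 1)) _ _ _ _
  · exact ρ.iSup_map_phi 1 (fun _ h => h.exists_succ K) (fun _ h => h.exists_pred K hn)
      (D222.eSet_eq t n) (D222.eSet_eq t (n + 1)) _ _ _ _
  · obtain ⟨n, rfl⟩ : ∃ m, n = m + 1 := ⟨n - 1, by omega⟩
    cases n with
    | zero =>
      have h : ρ.coxeter (D222.cumX0 1 hn) = ⊤ := by
        rw [D222.cumX0, ρ.coxeter.apply_sum, D222.gSet_one, iSup_singleton, ρ.coxeter.map_top]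
      rw [h]
      exact ρ.iSup_map_phi_top (D222.gSet_succ_eq le_rfl) _ _
    | succ n =>
      -- The sequences in x₀ are one shorter than its argument and have no prescribed start, so the
      -- levels are n + 1 and n + 2, taken over all t.
      refine ρ.iSup_map_phi 2 ?_ ?_ (D222.gSet_succ_eq (Nat.le_add_left 1 n))
        (D222.gSet_succ_eq (Nat.le_add_left 1 (n + 1))) _ _ _ _
      · rintro s ⟨t, h⟩
        obtain ⟨i, j, l, s', s'', h1, h2, h3, h4⟩ := h.exists_succ K
        exact ⟨i, j, l, s', s'', h1, ⟨t, h2⟩, ⟨t, h3⟩, h4⟩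
      · rintro s ⟨t, h⟩
        obtain ⟨i, s', h1, h2⟩ := h.exists_pred K (Nat.le_add_left 1 n)
        exact ⟨i, s', ⟨t, h1⟩, h2⟩
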